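/- **Setting.** A *part* is a path of stones coloured $\mathtt x$ (Left's) or $\mathtt o$ (Right's), considered up to reversal; a *game* is a finite multiset of parts, written as a sum, and $0$ is the game with no stones. A move of a player replaces an opponent stone adjacent to one of the player's stones by that stone, whose former cell becomes empty (so the part splits in two, one of which may be empty). Whoever cannot move loses. The negative $-p$ of a part $p$ is obtained by switching all colours. $\mathcal L$ is the class of games that Left wins when moving first and Right does not win when moving first. **Parts.** $\mathtt{a}n=\mathtt{oxox\cdots ox}$ ($n$ even), $\mathtt{o}n=\mathtt{oxo\cdots xo}$ ($n$ odd), $\mathtt{oo}n=\mathtt{ooxox\cdots}$ (an $\mathtt o$ followed by an alternating path starting with $\mathtt o$), $\mathtt{oo}n\mathtt{oo}=\mathtt{ooxo\cdots xoo}$ ($n$ odd), where $n$ is the total number of stones. In particular $\mathtt{oo3}=\mathtt{oox}$. **Standard form.** Algorithm ASF repeatedly applies to a game the first applicable rule in the order $\alpha,-\alpha,\beta,-\beta,\dots,\eta,-\eta$, until none applies: $\alpha$: $\mathtt{o},\mathtt{oo},\mathtt{ooo},\mathtt{ooxx},\mathtt{oxoxox}\Rightarrow 0$; $\beta$: $p+(-p)\Rightarrow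 0$; $\gamma$: $\mathtt{oxo},\mathtt{ooxox},\mathtt{ooxoxoo},\mathtt{xxoxoxx}\Rightarrow\mathtt{ox}$; $\delta$: $\mathtt{oxoxoxoxo}\Rightarrow\mathtt{ooxo}$; $\varepsilon$: $\mathtt{ooxoxx},\mathtt{oxoxoxoxoxox}\Rightarrow\mathtt{oxox}+\mathtt{ox}$; $\zeta$: $\mathtt{ooxoo}\Rightarrow\mathtt{oox}$; $\eta$: $\mathtt{ooxo}\Rightarrow\mathtt{xxo}+\mathtt{ox}$. The negative of a rule replaces every part in it by its negative. A game is in standard form if no rule applies to it. **Sets.** Let $\mathcal A'=\{\mathtt{a8},\mathtt{a10}\}\cup\{\mathtt an: n\ge 14\text{ even}\}$, $\mathcal O'=\{\mathtt{o5},\mathtt{o7}\}\cup\{\mathtt on:n\ge 11\text{ odd}\}$, $o\mathcal O'=\{\mathtt{oo}n:n\ge10\text{ even}\}$, $o\mathcal A'=\{\mathtt{oo}n:n\ge7\text{ odd}\}$, $o\mathcal Oo'=\{\mathtt{oo3}\}\cup\{\mathtt{oo}n\mathtt{oo}:n\ge9\text{ odd}\}$, $\mathcal I=\{\mathtt{a2},\mathtt{a4},\mathtt{oo6}\}$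 and $Q=\{\mathtt{o5}+\mathtt{a2},\ \mathtt{o7}+\mathtt{a4},\ \mathtt{o15}+\mathtt{a4}+\mathtt{a2}\}$. For a game $g$ with at least one part, in standard form and with all parts in $K=\mathcal O'\cup o\mathcal O'\cup o\mathcal Oo'\cup\mathcal I\cup\{\mathtt{xxo}\}\cup\{\mathtt{oo8}\}\cup\mathcal A'\cup o\mathcal A'$, let $(a,b,c,d,e,f,y,z)$ be the numbers (with multiplicity) of parts of $g$ in the eight sets of this union, respectively. Such a $g$ is in - $\mathcal S_0$ if $(y,z)\in\{(1,0),(0,0)\}$ and $a\ge c$, or $(y,z)=(0,1)$ and $a\ge c+1$; - $\mathcal S_1$ if $(y,z)=(0,0)$, $a\ge c+1$ and $g\notin Q$; - $\mathcal S_2$ if $y=z=a=b=c=0$, $e\ge1$, and $d=0$ or $d+e\ge3$. Let $LL=\{\mathtt{oo8},\ \mathtt{oo8}+\mathtt{xxo}+\mathtt{a4},\ \mathtt{o5}+\mathtt{oox}+\mathtt{a4}+\mathtt{a2},\ \mathtt{a14}+\mathtt{xxo}+\mathtt{a4}+\mathtt{a2}\}$. **Theorem.** From every game in $\mathcal S_0$,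 Left has a move to a game that Algorithm ASF converts into a game in $\mathcal S_1\cup\mathcal S_2\cup LL\cup\{0\}$. Moreover, every game in $LL$ is in $\mathcal L$. -/

import Mathlib

/-- A stone. Left owns the stones `x` and Right owns the stones `o`; we also use the
stone colour to name the player who owns it. -/
inductive Clobber.Stone
  | x
  | o
  deriving DecidableEq

namespace Clobber

open Stone

/-- The opposite colour (equivalently, the opponent). -/
def Stone.other : Stone → Stone
  | x => o
  | o => x

/-- A row of adjacent stones, read in one of its two directions, is the same part as the
row read in the other direction. -/
def rowSetoid : Setoid (List Stone) where
  r l m := l = m ∨ l = m.reverse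
  iseqv :=
    { refl := fun _ => Or.inl rfl
      symm := by
        rintro l m (h | h)
        · exact Or.inl h.symm
        · exact Or.inr (by rw [h, List.reverse_reverse])
      trans := by
        rintro l m n (h | h) (h' | h')
        · exact Or.inl (h.trans h')
        · exact Or.inr (h.trans h')
        · exact Or.inr (by rw [h, h'])
        · exact Or.inl (by rw [h, h', List.reverse_reverse]) }

/-- A part of a linear clobber game: a path of stones, up to reversal. -/
def Part : Type := Quotient rowSetoid

/-- The part given by a row of stones. -/
def part (l : List Stone) : Part := Quotient.mk rowSetoid l

/-- The negative of a part: every stone changes colour. -/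
instance : Neg Part where
  neg := Quotient.map (sa := rowSetoid) (sb := rowSetoid) (List.map Stone.other) (by
    rintro l m (h | h)
    · exact Or.inl (by rw [h])
    · exact Or.inr (by rw [h, List.map_reverse]))

/-- A linear clobber game is a finite multiset of parts; addition of multisets is the sum
of games, and the empty multiset `0` is the game with no stones. -/
abbrev Game : Type := Multiset Part

/-- The negative of a game. -/
def Game.negate (g : Game) : Game := g.map (fun p => -p)

/-- The game formed by one row of stones; an empty row contributes no part. -/
def row : List Stone → Game
  | [] => 0
  | s :: l => {part (s :: l)}

/-- The moves of the player `s` on one row: a stone `s` replaces an adjacent stone of the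
other colour, and its former cell becomes empty, which splits the row in two. -/
inductive RowMove (s : Stone) : List Stone → Game → Prop
  | clobberRight (u v : List Stone) :
      RowMove s (u ++ s :: s.other :: v) (row u + row (s :: v))
  | clobberLeft (u v : List Stone) :
      RowMove s (u ++ s.other :: s :: v) (row (u ++ [s]) + row v)

/-- The player `s` can move from the game `g` to the game `h`. -/
def Move (s : Stone) (g h : Game) : Prop :=
  ∃ (l : List Stone) (j r : Game), RowMove s l j ∧ g = part l ::ₘ r ∧ h = j + r

/-- The player `s` has a winning strategy on the game when playing first
(whoever cannot move loses). -/
inductive WinsFirst (s : Stone) : Game → Prop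
  | intro (g h : Game) (hgh : Move s g h)
      (hwin : ∀ k, Move s.other h k → WinsFirst s k) : WinsFirst s g

/-- The outcome class `𝓛`: Left wins playing first, Right does not win playing first. -/
def classL : Set Game := {g | WinsFirst x g ∧ ¬ WinsFirst o g}

/-- The alternating row with `n` stones whose first stone is `s`. -/
def alt (s : Stone) : ℕ → List Stone
  | 0 => []
  | n + 1 => s :: alt s.other n

/-- For even `n` the part `a(n) = oxox…ox`; for odd `n` the part `o(n) = oxox…xo`. -/
def altPart (n : ℕ) : Part := part (alt o n)

/-- The part `oo(n) = ooxox…` with `n` stones, an `o` before an alternating row (`n ≥ 1`). -/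
def ooPart (n : ℕ) : Part := part (o :: alt o (n - 1))

/-- The part `oo(n)oo = ooxo…xoo` with `n` stones (`n` odd, `n ≥ 3`). -/
def ooPartoo (n : ℕ) : Part := part (o :: (alt o (n - 2) ++ [o]))

/-- The part `xxo`. -/
def xxo : Part := part [x, x, o]

/-! ### Algorithm standard form -/

/-- The rewriting rule that replaces one part from the list `lhs` by the game `rhs`. -/
def Replace (lhs : List Part) (rhs : Game) (g h : Game) : Prop :=
  ∃ p ∈ lhs, ∃ r : Game, g = p ::ₘ r ∧ h = rhs + r

/-- The negative of a replacement rule. -/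
def ReplaceNeg (lhs : List Part) (rhs : Game) (g h : Game) : Prop :=
  Replace (lhs.map (fun p => -p)) rhs.negate g h

/-- The rule that deletes two parts `p` and `-p`. It is its own negative. -/
def Cancel (g h : Game) : Prop :=
  ∃ p : Part, g = p ::ₘ (-p) ::ₘ h

/-- Left-hand side of rule `α`: `o, oo, ooo, ooxx, oxoxox`. -/
def lhsα : List Part :=
  [part [o], part [o, o], part [o, o, o], part [o, o, x, x], part [o, x, o, x, o, x]]

/-- Left-hand side of rule `γ`: `oxo, ooxox, ooxoxoo, xxoxoxx`. -/
def lhsγ : List Part :=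
  [part [o, x, o], part [o, o, x, o, x], part [o, o, x, o, x, o, o],
    part [x, x, o, x, o, x, x]]

/-- Left-hand side of rule `δ`: `oxoxoxoxo`. -/
def lhsδ : List Part := [part [o, x, o, x, o, x, o, x, o]]

/-- Left-hand side of rule `ε`: `ooxoxx, oxoxoxoxoxox`. -/
def lhsε : List Part :=
  [part [o, o, x, o, x, x], part [o, x, o, x, o, x, o, x, o, x, o, x]]

/-- Left-hand side of rule `ζ`: `ooxoo`. -/
def lhsζ : List Part := [part [o, o, x, o, o]]

/-- Left-hand side of rule `η`: `ooxo`. -/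
def lhsη : List Part := [part [o, o, x, o]]

/-- The rules `α, -α, β, -β, γ, -γ, δ, -δ, ε, -ε, ζ, -ζ, η, -η`, in order of preference. -/
def rules : List (Game → Game → Prop) :=
  [Replace lhsα 0, ReplaceNeg lhsα 0,
   Cancel, Cancel,
   Replace lhsγ {part [o, x]}, ReplaceNeg lhsγ {part [o, x]},
   Replace lhsδ {part [o, o, x, o]}, ReplaceNeg lhsδ {part [o, o, x, o]},
   Replace lhsε {part [o, x, o, x], part [o, x]},
   ReplaceNeg lhsε {part [o, x, o, x], part [o, x]},
   Replace lhsζ {part [o, o, x]}, ReplaceNeg lhsζ {part [o, o, x]},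
   Replace lhsη {part [x, x, o], part [o, x]},
   ReplaceNeg lhsη {part [x, x, o], part [o, x]}]

/-- One step of the algorithm: an application of the first rule of the list that applies. -/
def Step (g h : Game) : Prop :=
  ∃ (before : List (Game → Game → Prop)) (R : Game → Game → Prop)
    (after : List (Game → Game → Prop)),
    rules = before ++ R :: after ∧ R g h ∧ ∀ R' ∈ before, ∀ k, ¬ R' g k

/-- A game is in standard form if no rule applies to it. -/
def IsStandardForm (g : Game) : Prop := ∀ R ∈ rules, ∀ h, ¬ R g h

/-- The algorithm converts the game `g` into the standard form `h`. -/
def ASF (g h : Game) : Prop := Relation.ReflTransGen Step g h ∧ IsStandardForm h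

/-! ### The sets of parts and of games -/

/-- `𝒜' = {a8, a10, a14, a16, …}`. -/
def setA' : Set Part := {p | ∃ n, Even n ∧ (n = 8 ∨ n = 10 ∨ 14 ≤ n) ∧ p = altPart n}

/-- `𝒪' = {o5, o7, o11, o13, …}`. -/
def setO' : Set Part := {p | ∃ n, Odd n ∧ (n = 5 ∨ n = 7 ∨ 11 ≤ n) ∧ p = altPart n}

/-- `o𝒪' = {oo10, oo12, …}`. -/
def setoO' : Set Part := {p | ∃ n, Even n ∧ 10 ≤ n ∧ p = ooPart n}

/-- `o𝒜' = {oo7, oo9, …}`. -/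
def setoA' : Set Part := {p | ∃ n, Odd n ∧ 7 ≤ n ∧ p = ooPart n}

/-- `o𝒪o' = {oo3, oo9oo, oo11oo, …}`. -/
def setoOo' : Set Part := {p | p = ooPart 3 ∨ ∃ n, Odd n ∧ 9 ≤ n ∧ p = ooPartoo n}

/-- `𝓘 = {a2, a4, oo6}`. -/
def setI : Set Part := {altPart 2, altPart 4, ooPart 6}

/-- `K`, the set of all parts allowed in the games of `𝒮`. -/
def setK : Set Part :=
  setO' ∪ setoO' ∪ setoOo' ∪ setI ∪ {xxo} ∪ {ooPart 8} ∪ setA' ∪ setoA'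

/-- `Q = {o5 + a2, o7 + a4, o15 + a4 + a2}`. -/
def setQ : Set Game :=
  {{altPart 5, altPart 2}, {altPart 7, altPart 4}, {altPart 15, altPart 4, altPart 2}}

open Classical in
/-- The number of (not necessarily distinct) parts of `g` that are in `P`. -/
noncomputable def count (P : Set Part) (g : Game) : ℕ := g.countP (fun p => p ∈ P)

/-- The first entry `a` of the count vector. -/
noncomputable def cntA (g : Game) : ℕ := count setO' g
/-- The entry `b` of the count vector. -/
noncomputable def cntB (g : Game) : ℕ := count setoO' g
/-- The entry `c` of the count vector. -/
noncomputable def cntC (g : Game) : ℕ := count setoOo' g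
/-- The entry `d` of the count vector. -/
noncomputable def cntD (g : Game) : ℕ := count setI g
/-- The entry `e` of the count vector. -/
noncomputable def cntE (g : Game) : ℕ := count {xxo} g
/-- The entry `y` of the count vector. -/
noncomputable def cntY (g : Game) : ℕ := count setA' g
/-- The entry `z` of the count vector. -/
noncomputable def cntZ (g : Game) : ℕ := count setoA' g

/-- The non-empty games in standard form with all parts in `K`. -/
def base : Set Game := {g | g ≠ 0 ∧ IsStandardForm g ∧ ∀ p ∈ g, p ∈ setK}

/-- `𝒮₀`. -/
def S0 : Set Game :=
  {g | g ∈ base ∧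
    ((cntY g = 1 ∧ cntZ g = 0 ∧ cntC g ≤ cntA g) ∨
     (cntY g = 0 ∧ cntZ g = 0 ∧ cntC g ≤ cntA g) ∨
     (cntY g = 0 ∧ cntZ g = 1 ∧ cntC g + 1 ≤ cntA g))}

/-- `𝒮₁`. -/
def S1 : Set Game :=
  {g | g ∈ base ∧ cntY g = 0 ∧ cntZ g = 0 ∧ cntC g + 1 ≤ cntA g ∧ g ∉ setQ}

/-- `𝒮₂`. -/
def S2 : Set Game :=
  {g | g ∈ base ∧ cntY g = 0 ∧ cntZ g = 0 ∧ cntA g = 0 ∧ cntB g = 0 ∧ cntC g = 0 ∧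
    1 ≤ cntE g ∧ (cntD g = 0 ∨ 3 ≤ cntD g + cntE g)}

/-- `LL = {oo8, oo8 + xxo + a4, o5 + oox + a4 + a2, a14 + xxo + a4 + a2}`. -/
def setLL : Set Game :=
  {{ooPart 8}, {ooPart 8, xxo, altPart 4},
   {altPart 5, ooPart 3, altPart 4, altPart 2},
   {altPart 14, xxo, altPart 4, altPart 2}}

end Clobber

namespace Clobber

open Stone

/-! ### Invariants of parts -/

/-! Left's main aim is a game with `y = z = 0` and `a ≥ c + 1`: he creates a part of 𝒪', spends a
part of o𝒪o', or shortens a row without harming the balance. The kinds of parts are tried in the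
order 𝒜', o𝒜', o𝒪o', 𝒪', o𝒪', `oo8`, and finally 𝓘 ∪ {`xxo`}. Typical moves are a(n) → o(n−3) + xx,
oo(n) → oo(n−3) + xx for odd n, oox → ox, oo(n)oo → ox + oo(n−3), o(n) → xxo + o(n−4), and oo(n) →
ox + o(n−3) or ooxx + o(n−5) for even n. Such a move can fail when the new part is `o9`, which is
not in 𝒪', or when the standard form lies in `Q`. Each failure leaves a few explicit games, for
which another move works; the last three games of `LL` are needed only there. The targets 𝒮₂ and 0
serve mainly the games with all parts in 𝓘 ∪ {`xxo`}. The cases are assembled in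
`hasGoodMove_of_mem_S0`.

The standard form is controlled without running the algorithm. Length, excess of `o` over `x`, and
number of equal neighbours separate `K` from all left-hand sides of replacement rules and from their
negatives, so on games over `K` only cancellation acts (`isStandardForm_of_K`). In `K` the only
cancelling pairs are two equal even alternating rows, or `xxo` with `oox`. Hence `a` is unchanged,
no other count grows, and `exists_asf_mem_S1` gives membership in 𝒮₁ without knowing which pairs
cancel. The fragments outside `K` created by the moves are removed by ±α or rewritten by ±η.

For `LL ⊆ 𝓛` there is a finite certificate, `answerCodes`: a list of positions such that after any
move of Right, Left can return to the list. Right therefore loses when starting from a listed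
position, and Left wins when starting from any position with a move into the list. Each game of `LL`
is of both kinds. The certificate is checked by evaluation. -/

@[simp] theorem Stone.other_x : Stone.x.other = Stone.o := rfl

@[simp] theorem Stone.other_o : Stone.o.other = Stone.x := rfl

@[simp] theorem Stone.other_other (s : Stone) : s.other.other = s := by cases s <;> rfl

/-- The number of pairs of equal neighbours in a row. -/
def doubles : List Stone → ℕ
  | [] => 0
  | s :: l => doubles l + if l.head? = some s then 1 else 0

theorem doubles_append_singleton (l : List Stone) (s : Stone) :
    doubles (l ++ [s]) = doubles l + if l.getLast? = some s then 1 else 0 := by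
  induction l with
  | nil => simp [doubles]
  | cons t l ih =>
    cases l with
    | nil => cases s <;> cases t <;> rfl
    | cons u l =>
      change doubles ((u :: l) ++ [s]) + (if some u = some t then 1 else 0) =
        doubles (u :: l) + (if some u = some t then 1 else 0) + _
      rw [ih, List.getLast?_cons_cons, add_right_comm]

theorem doubles_reverse (l : List Stone) : doubles l.reverse = doubles l := by
  induction l with
  | nil => rfl
  | cons s l ih =>
    rw [List.reverse_cons, doubles_append_singleton, ih, doubles, List.getLast?_reverse]

theorem doubles_map_other (l : List Stone) : doubles (l.map Stone.other) = doubles l := by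
  induction l with
  | nil => rfl
  | cons s l ih =>
    rw [List.map_cons, doubles, doubles, ih]
    cases l with
    | nil => rfl
    | cons t l => cases s <;> cases t <;> rfl

/-- The number of stones `o` minus the number of stones `x` in a row. -/
def excess : List Stone → ℤ
  | [] => 0
  | x :: l => excess l - 1
  | o :: l => excess l + 1

theorem excess_append (l m : List Stone) : excess (l ++ m) = excess l + excess m := by
  induction l with
  | nil => simp [excess]
  | cons s l ih => cases s <;> simp only [List.cons_append, excess, ih] <;> ring

theorem excess_reverse (l : List Stone) : excess l.reverse = excess l := by
  induction l with
  | nil => rfl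
  | cons s l ih =>
    rw [List.reverse_cons, excess_append, ih]
    cases s <;> simp [excess] ; ring

theorem excess_map_other (l : List Stone) : excess (l.map Stone.other) = -excess l := by
  induction l with
  | nil => rfl
  | cons s l ih => cases s <;> simp [excess, ih, Stone.other] <;> ring

/-- Length, excess and number of doubles of a row. -/
def rowInv (l : List Stone) : ℕ × ℤ × ℕ := (l.length, excess l, doubles l)

/-- Length, excess and number of doubles of a part. -/
def inv : Part → ℕ × ℤ × ℕ :=
  Quotient.lift rowInv (by
    rintro l m (h | h)
    · rw [h]
    · simp [h, rowInv, excess_reverse, doubles_reverse])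

theorem inv_part (l : List Stone) : inv (part l) = rowInv l := rfl

theorem neg_part (l : List Stone) : -part l = part (l.map Stone.other) := rfl

theorem inv_neg (p : Part) : inv (-p) = ((inv p).1, -(inv p).2.1, (inv p).2.2) := by
  induction p using Quotient.inductionOn with
  | h l =>
    change rowInv (l.map Stone.other) = _
    simp [rowInv, excess_map_other, doubles_map_other, inv]

theorem neg_neg_part (p : Part) : - -p = p := by
  induction p using Quotient.inductionOn with
  | h l =>
    change part ((l.map Stone.other).map Stone.other) = part l
    simp [Function.comp_def]

theorem part_reverse (l : List Stone) : part l.reverse = part l :=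
  Quotient.sound (Or.inr rfl)

/-! ### Alternating rows -/

theorem length_alt (s : Stone) (n : ℕ) : (alt s n).length = n := by
  induction n generalizing s with
  | zero => rfl
  | succ n ih => simp [alt, ih]

theorem doubles_alt (s : Stone) (n : ℕ) : doubles (alt s n) = 0 := by
  induction n generalizing s with
  | zero => rfl
  | succ n ih =>
    rw [alt, doubles, ih]
    cases n <;> cases s <;> simp [alt]

theorem excess_alt_o (n : ℕ) : excess (alt o n) = (n % 2 : ℕ) := by
  induction n using Nat.twoStepInduction with
  | zero => rfl
  | one => rfl
  | more n ih _ => simp [alt, excess, ih]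

theorem alt_add_of_even (s : Stone) {m : ℕ} (hm : Even m) (n : ℕ) :
    alt s (m + n) = alt s m ++ alt s n := by
  obtain ⟨k, rfl⟩ := hm
  induction k with
  | zero => simp [alt]
  | succ k ih =>
    rw [show k + 1 + (k + 1) + n = k + k + n + 1 + 1 by ring,
      show k + 1 + (k + 1) = k + k + 1 + 1 by ring]
    simp [alt, ih]

theorem alt_add_of_odd (s : Stone) {m : ℕ} (hm : Odd m) (n : ℕ) :
    alt s (m + n) = alt s m ++ alt s.other n := by
  obtain ⟨k, rfl⟩ := hm
  rw [add_assoc, alt_add_of_even s (even_two_mul k), alt_add_of_even s (even_two_mul k),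
    add_comm 1 n]
  simp [alt]

theorem map_other_alt (s : Stone) (n : ℕ) : (alt s n).map Stone.other = alt s.other n := by
  induction n generalizing s with
  | zero => rfl
  | succ n ih => simp [alt, ih]

theorem reverse_alt_of_odd (s : Stone) {n : ℕ} (hn : Odd n) : (alt s n).reverse = alt s n := by
  obtain ⟨k, rfl⟩ := hn
  induction k with
  | zero => rfl
  | succ k ih =>
    rw [show 2 * (k + 1) + 1 = 2 + (2 * k + 1) by ring, alt_add_of_even s even_two,
      List.reverse_append, ih]
    conv_rhs => rw [← alt_add_of_even s even_two, add_comm, alt_add_of_odd s (odd_two_mul_add_one k)]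
    cases s <;> rfl

theorem reverse_alt_of_even (s : Stone) {n : ℕ} (hn : Even n) :
    (alt s n).reverse = alt s.other n := by
  cases n with
  | zero => rfl
  | succ n =>
    have hn' : Odd n := by simpa [parity_simps] using hn
    rw [alt_add_of_odd s hn', List.reverse_append, reverse_alt_of_odd s hn']
    simp [alt]

/-! ### The families of parts -/

theorem inv_altPart (n : ℕ) : inv (altPart n) = (n, ((n % 2 : ℕ) : ℤ), 0) := by
  simp [altPart, inv_part, rowInv, length_alt, doubles_alt, excess_alt_o]

theorem inv_ooPart {n : ℕ} (hn : 2 ≤ n) :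
    inv (ooPart n) = (n, (((n + 1) % 2 : ℕ) : ℤ) + 1, 1) := by
  obtain ⟨k, rfl⟩ := Nat.exists_eq_add_of_le' hn
  simp only [ooPart, inv_part, rowInv, List.length_cons, length_alt, doubles, doubles_alt, excess,
    excess_alt_o]
  rw [show k + 2 - 1 = k + 1 by omega, show (k + 2 + 1) % 2 = (k + 1) % 2 by omega]
  simp [alt]

theorem inv_ooPartoo {n : ℕ} (hn : 3 ≤ n) (ho : Odd n) : inv (ooPartoo n) = (n, 3, 2) := by
  obtain ⟨k, rfl⟩ := Nat.exists_eq_add_of_le' hn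
  have hk : Odd (k + 1) := by obtain ⟨m, hm⟩ := ho; exact ⟨m - 1, by omega⟩
  have hl : (alt o (k + 1)).getLast? = some o := by
    rw [← List.head?_reverse, reverse_alt_of_odd o hk]; rfl
  simp only [ooPartoo, inv_part, rowInv, show k + 3 - 2 = k + 1 by omega, doubles,
    doubles_append_singleton, doubles_alt, hl, excess, excess_append, excess_alt_o,
    Nat.odd_iff.1 hk]
  simp [alt, length_alt]

theorem inv_xxo : inv xxo = (3, -1, 1) := rfl

theorem altPart_injective : Function.Injective altPart := fun m n h => by
  simpa [inv_altPart] using congrArg (fun p => (inv p).1) h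

@[simp] theorem altPart_inj {m n : ℕ} : altPart m = altPart n ↔ m = n := altPart_injective.eq_iff

theorem altPart_ne_ooPart (m : ℕ) {n : ℕ} (hn : 2 ≤ n) : altPart m ≠ ooPart n := fun h => by
  simpa [inv_altPart, inv_ooPart hn] using congrArg (fun p => (inv p).2.2) h

theorem altPart_ne_ooPartoo (m : ℕ) {n : ℕ} (hn : 3 ≤ n) (ho : Odd n) :
    altPart m ≠ ooPartoo n := fun h => by
  simpa [inv_altPart, inv_ooPartoo hn ho] using congrArg (fun p => (inv p).2.2) h

theorem ooPart_ne_ooPartoo {m n : ℕ} (hm : 2 ≤ m) (hn : 3 ≤ n) (ho : Odd n) :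
    ooPart m ≠ ooPartoo n := fun h => by
  simpa [inv_ooPart hm, inv_ooPartoo hn ho] using congrArg (fun p => (inv p).2.2) h

@[simp] theorem altPart_ne_xxo (m : ℕ) : altPart m ≠ xxo := fun h => by
  simpa [inv_altPart, inv_xxo] using congrArg (fun p => (inv p).2.2) h

theorem ooPart_ne_xxo {m : ℕ} (hm : 2 ≤ m) : ooPart m ≠ xxo := fun h => by
  have := congrArg (fun p => (inv p).2.1) h
  simp only [inv_ooPart hm, inv_xxo] at this
  omega

theorem ooPart_inj {m n : ℕ} (hm : 2 ≤ m) (hn : 2 ≤ n) : ooPart m = ooPart n ↔ m = n := by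
  refine ⟨fun h => ?_, fun h => by rw [h]⟩
  simpa [inv_ooPart hm, inv_ooPart hn] using congrArg (fun p => (inv p).1) h

theorem ooPartoo_ne_xxo {n : ℕ} (hn : 3 ≤ n) (ho : Odd n) : ooPartoo n ≠ xxo := fun h => by
  simpa [inv_xxo, inv_ooPartoo hn ho] using congrArg (fun p => (inv p).2.2) h

section Membership

variable {n : ℕ}

@[simp] theorem altPart_mem_setA' :
    altPart n ∈ setA' ↔ Even n ∧ (n = 8 ∨ n = 10 ∨ 14 ≤ n) := by
  simp [setA']

@[simp] theorem altPart_mem_setO' :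
    altPart n ∈ setO' ↔ Odd n ∧ (n = 5 ∨ n = 7 ∨ 11 ≤ n) := by
  simp [setO']

@[simp] theorem altPart_notMem_setoO' : altPart n ∉ setoO' := by
  rintro ⟨m, -, hm, h⟩
  exact altPart_ne_ooPart n (by omega) h

@[simp] theorem altPart_notMem_setoA' : altPart n ∉ setoA' := by
  rintro ⟨m, -, hm, h⟩
  exact altPart_ne_ooPart n (by omega) h

@[simp] theorem altPart_notMem_setoOo' : altPart n ∉ setoOo' := by
  rintro (h | ⟨m, ho, hm, h⟩)
  · exact altPart_ne_ooPart n (by omega) h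
  · exact altPart_ne_ooPartoo n (by omega) ho h

@[simp] theorem altPart_mem_setI : altPart n ∈ setI ↔ n = 2 ∨ n = 4 := by
  simp [setI, altPart_ne_ooPart n (show 2 ≤ 6 by omega)]

theorem ooPart_notMem_setA' (hn : 2 ≤ n) : ooPart n ∉ setA' := by
  rintro ⟨m, -, -, h⟩
  exact altPart_ne_ooPart m hn h.symm

theorem ooPart_notMem_setO' (hn : 2 ≤ n) : ooPart n ∉ setO' := by
  rintro ⟨m, -, -, h⟩
  exact altPart_ne_ooPart m hn h.symm

theorem ooPart_mem_setoO' (hn : 2 ≤ n) : ooPart n ∈ setoO' ↔ Even n ∧ 10 ≤ n := by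
  refine ⟨?_, fun h => ⟨n, h.1, h.2, rfl⟩⟩
  rintro ⟨m, hm, hm', h⟩
  rw [ooPart_inj hn (by omega)] at h
  exact h ▸ ⟨hm, hm'⟩

theorem ooPart_mem_setoA' (hn : 2 ≤ n) : ooPart n ∈ setoA' ↔ Odd n ∧ 7 ≤ n := by
  refine ⟨?_, fun h => ⟨n, h.1, h.2, rfl⟩⟩
  rintro ⟨m, hm, hm', h⟩
  rw [ooPart_inj hn (by omega)] at h
  exact h ▸ ⟨hm, hm'⟩

theorem ooPart_mem_setoOo' (hn : 2 ≤ n) : ooPart n ∈ setoOo' ↔ n = 3 := by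
  refine ⟨?_, fun h => Or.inl (by rw [h])⟩
  rintro (h | ⟨m, hm, hm', h⟩)
  · rwa [ooPart_inj hn (by omega)] at h
  · exact absurd h (ooPart_ne_ooPartoo hn (by omega) hm)

theorem ooPart_mem_setI (hn : 2 ≤ n) : ooPart n ∈ setI ↔ n = 6 := by
  simp [setI, (altPart_ne_ooPart _ hn).symm, ooPart_inj hn]

@[simp] theorem xxo_notMem_setA' : xxo ∉ setA' := by
  rintro ⟨m, -, -, h⟩
  exact altPart_ne_xxo m h.symm

@[simp] theorem xxo_notMem_setO' : xxo ∉ setO' := by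
  rintro ⟨m, -, -, h⟩
  exact altPart_ne_xxo m h.symm

@[simp] theorem xxo_notMem_setoO' : xxo ∉ setoO' := by
  rintro ⟨m, -, hm, h⟩
  exact ooPart_ne_xxo (by omega) h.symm

@[simp] theorem xxo_notMem_setoA' : xxo ∉ setoA' := by
  rintro ⟨m, -, hm, h⟩
  exact ooPart_ne_xxo (by omega) h.symm

@[simp] theorem xxo_notMem_setoOo' : xxo ∉ setoOo' := by
  rintro (h | ⟨m, ho, hm, h⟩)
  · exact ooPart_ne_xxo (by omega) h.symm
  · exact ooPartoo_ne_xxo (by omega) ho h.symm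

@[simp] theorem xxo_notMem_setI : xxo ∉ setI := by
  simp [setI, (altPart_ne_xxo _).symm, (ooPart_ne_xxo (show 2 ≤ 6 by omega)).symm]

@[simp] theorem altPart_mem_setK :
    altPart n ∈ setK ↔ n = 2 ∨ n = 4 ∨ n = 5 ∨ n = 7 ∨ n = 8 ∨ n = 10 ∨ n = 11 ∨ 13 ≤ n := by
  simp only [setK, Set.mem_union, altPart_mem_setO', altPart_notMem_setoO',
    altPart_notMem_setoOo', altPart_mem_setI, Set.mem_singleton_iff, altPart_ne_xxo,
    altPart_ne_ooPart n (show 2 ≤ 8 by omega), altPart_mem_setA', altPart_notMem_setoA',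
    Nat.odd_iff, Nat.even_iff, or_false]
  omega

theorem ooPart_mem_setK (hn : 2 ≤ n) : ooPart n ∈ setK ↔ n = 3 ∨ 6 ≤ n := by
  simp only [setK, Set.mem_union, ooPart_notMem_setO' hn, ooPart_mem_setoO' hn,
    ooPart_mem_setoOo' hn, ooPart_mem_setI hn, Set.mem_singleton_iff, ooPart_ne_xxo hn,
    ooPart_inj hn (show 2 ≤ 8 by omega), ooPart_notMem_setA' hn, ooPart_mem_setoA' hn,
    Nat.odd_iff, Nat.even_iff, false_or, or_false]
  omega

@[simp] theorem xxo_mem_setK : xxo ∈ setK := by simp [setK]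

end Membership

/-- Every part in `K` belongs to one of the four families. -/
theorem exists_of_mem_setK {p : Part} (hp : p ∈ setK) :
    (∃ n, p = altPart n) ∨ (∃ n, (n = 3 ∨ 6 ≤ n) ∧ p = ooPart n) ∨
      (∃ n, Odd n ∧ 9 ≤ n ∧ p = ooPartoo n) ∨ p = xxo := by
  rcases hp with ((((((h | h) | h) | h) | h) | h) | h) | h
  · obtain ⟨n, -, -, h⟩ := h; exact Or.inl ⟨n, h⟩
  · obtain ⟨n, -, hn, h⟩ := h; exact Or.inr (Or.inl ⟨n, by omega, h⟩)
  · rcases h with h | h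
    · exact Or.inr (Or.inl ⟨3, by omega, h⟩)
    · exact Or.inr (Or.inr (Or.inl h))
  · rcases h with h | h | h
    · exact Or.inl ⟨_, h⟩
    · exact Or.inl ⟨_, h⟩
    · exact Or.inr (Or.inl ⟨6, by omega, h⟩)
  · exact Or.inr (Or.inr (Or.inr h))
  · exact Or.inr (Or.inl ⟨8, by omega, h⟩)
  · obtain ⟨n, -, -, h⟩ := h; exact Or.inl ⟨n, h⟩
  · obtain ⟨n, -, hn, h⟩ := h; exact Or.inr (Or.inl ⟨n, by omega, h⟩)

/-- The invariants that parts in `K` can have. -/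
def KInv (i : ℕ × ℤ × ℕ) : Prop :=
  (i.2.1 = (i.1 % 2 : ℕ) ∧ i.2.2 = 0 ∧
    (i.1 = 2 ∨ i.1 = 4 ∨ i.1 = 5 ∨ i.1 = 7 ∨ i.1 = 8 ∨ i.1 = 10 ∨ i.1 = 11 ∨ 13 ≤ i.1)) ∨
  (i.2.1 = ((i.1 + 1) % 2 : ℕ) + 1 ∧ i.2.2 = 1 ∧ (i.1 = 3 ∨ 6 ≤ i.1)) ∨
  (i.2.1 = 3 ∧ i.2.2 = 2 ∧ 9 ≤ i.1) ∨ i = (3, -1, 1)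

instance : DecidablePred KInv := fun i => by unfold KInv; infer_instance

theorem kInv_of_mem_setK {p : Part} (hp : p ∈ setK) : KInv (inv p) := by
  rcases exists_of_mem_setK hp with ⟨n, rfl⟩ | ⟨n, hn, rfl⟩ | ⟨n, ho, hn, rfl⟩ | rfl
  · rw [altPart_mem_setK] at hp
    exact Or.inl (by simpa [inv_altPart] using hp)
  · rw [inv_ooPart (by omega)]
    exact Or.inr (Or.inl ⟨rfl, rfl, hn⟩)
  · rw [inv_ooPartoo (by omega) ho]
    exact Or.inr (Or.inr (Or.inl ⟨rfl, rfl, hn⟩))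
  · exact Or.inr (Or.inr (Or.inr rfl))

theorem neg_altPart_of_even {n : ℕ} (hn : Even n) : -altPart n = altPart n := by
  rw [altPart, neg_part, map_other_alt, ← reverse_alt_of_even o hn, part_reverse]

theorem neg_xxo : -xxo = ooPart 3 := Quotient.sound (Or.inl rfl)

/-- The excess would be −1, which in `K` occurs only for `xxo`, and `xxo` has two equal neighbours.
-/
theorem neg_altPart_notMem_setK {n : ℕ} (hn : Odd n) : -altPart n ∉ setK := fun h => by
  have := kInv_of_mem_setK h
  simp [inv_neg, inv_altPart, KInv, Nat.odd_iff.1 hn] at this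

/-- The excess would be negative, and `xxo`, the only such part of `K`, has just three stones. -/
theorem neg_ooPart_notMem_setK {n : ℕ} (hn : 4 ≤ n) : -ooPart n ∉ setK := fun h => by
  have := kInv_of_mem_setK h
  simp [inv_neg, inv_ooPart (show 2 ≤ n by omega), KInv] at this
  rcases this with h | h <;> omega

/-! ### Games that the algorithm changes by cancellation only -/

instance : DecidableRel rowSetoid.r := fun l m =>
  inferInstanceAs (Decidable (l = m ∨ l = m.reverse))

instance : DecidableEq Part :=
  @Quotient.decidableEq (List Stone) rowSetoid
    (fun l m => inferInstanceAs (Decidable (rowSetoid.r l m)))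

/-- The parts that a rule can replace, up to negation. -/
def allLhs : List Part := lhsα ++ lhsγ ++ lhsδ ++ lhsε ++ lhsζ ++ lhsη

/-- `K` is infinite, but the three invariants reduce its disjointness from the left-hand sides to
finitely many decidable comparisons. -/
theorem not_kInv_of_mem_allLhs :
    ∀ p ∈ allLhs, ¬ KInv (inv p) ∧ ¬ KInv (inv (-p)) := by
  decide

theorem notMem_allLhs {p : Part} (hp : p ∈ setK) :
    p ∉ allLhs ∧ p ∉ allLhs.map (fun q => -q) := by
  refine ⟨fun h => (not_kInv_of_mem_allLhs p h).1 (kInv_of_mem_setK hp), fun h => ?_⟩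
  obtain ⟨q, hq, rfl⟩ := List.mem_map.1 h
  exact (not_kInv_of_mem_allLhs q hq).2 (kInv_of_mem_setK hp)

theorem not_replace {lhs : List Part} {rhs g : Game} (hg : ∀ p ∈ g, p ∉ lhs) (h : Game) :
    ¬ Replace lhs rhs g h := by
  rintro ⟨p, hp, r, rfl, -⟩
  exact hg p (Multiset.mem_cons_self p r) hp

theorem notMem_lhs {p : Part} (hp : p ∈ setK) {lhs : List Part} (hl : lhs ⊆ allLhs) :
    p ∉ lhs ∧ p ∉ lhs.map (fun q => -q) :=
  ⟨fun h => (notMem_allLhs hp).1 (hl h),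
    fun h => (notMem_allLhs hp).2 (List.map_subset _ hl h)⟩

theorem lhsα_subset : lhsα ⊆ allLhs := by decide

theorem not_replace_of_K {g : Game} (hg : ∀ p ∈ g, p ∈ setK) {lhs : List Part}
    (hl : lhs ⊆ allLhs) (rhs h : Game) : ¬ Replace lhs rhs g h ∧ ¬ ReplaceNeg lhs rhs g h :=
  ⟨not_replace (fun p hp => (notMem_lhs (hg p hp) hl).1) h,
    not_replace (fun p hp => (notMem_lhs (hg p hp) hl).2) h⟩

/-- The rule that cancels a part and its negative does not apply to `g`. -/
def NoCancel (g : Game) : Prop := ∀ h, ¬ Cancel g h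

/-- All left-hand sides of replacement rules and their negatives lie outside `K`, so only rule β
could still apply. -/
theorem isStandardForm_of_K {g : Game} (hg : ∀ p ∈ g, p ∈ setK) (hc : NoCancel g) :
    IsStandardForm g := by
  intro R hR h
  have key := fun lhs hl rhs => not_replace_of_K hg (lhs := lhs) hl rhs h
  simp only [rules, List.mem_cons, List.not_mem_nil, or_false] at hR
  rcases hR with rfl | rfl | rfl | rfl | rfl | rfl | rfl | rfl | rfl | rfl | rfl | rfl | rfl | rfl
  · exact (key lhsα (by decide) _).1
  · exact (key lhsα (by decide) _).2
  · exact hc h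
  · exact hc h
  · exact (key lhsγ (by decide) _).1
  · exact (key lhsγ (by decide) _).2
  · exact (key lhsδ (by decide) _).1
  · exact (key lhsδ (by decide) _).2
  · exact (key lhsε (by decide) _).1
  · exact (key lhsε (by decide) _).2
  · exact (key lhsζ (by decide) _).1
  · exact (key lhsζ (by decide) _).2
  · exact (key lhsη (by decide) _).1
  · exact (key lhsη (by decide) _).2

theorem IsStandardForm.noCancel {g : Game} (hg : IsStandardForm g) : NoCancel g :=
  hg Cancel (by simp [rules])

theorem NoCancel.mono {g h : Game} (hg : NoCancel g) (hle : h ≤ g) : NoCancel h := by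
  rintro k ⟨p, rfl⟩
  obtain ⟨m, rfl⟩ := Multiset.le_iff_exists_add.1 hle
  exact hg (k + m) ⟨p, by simp⟩

theorem NoCancel.of_cons {p : Part} {g : Game} (hg : NoCancel (p ::ₘ g)) : NoCancel g :=
  hg.mono (Multiset.le_cons_self g p)

theorem NoCancel.neg_notMem {p : Part} {g : Game} (hg : NoCancel (p ::ₘ g)) : -p ∉ g := by
  intro h
  obtain ⟨k, rfl⟩ := Multiset.exists_cons_of_mem h
  exact hg k ⟨p, rfl⟩

theorem NoCancel.cons {p : Part} {g : Game} (hg : NoCancel g) (hp : -p ∉ g) :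
    NoCancel (p ::ₘ g) := by
  rintro k ⟨q, hq⟩
  rcases Multiset.cons_eq_cons.1 hq with ⟨rfl, rfl⟩ | ⟨-, c, rfl, hc⟩
  · exact hp (Multiset.mem_cons_self _ _)
  · rcases Multiset.cons_eq_cons.1 hc with ⟨rfl, rfl⟩ | ⟨-, d, rfl, rfl⟩
    · exact hp (by simp [neg_neg_part])
    · exact hg d ⟨q, rfl⟩

theorem noCancel_zero : NoCancel 0 := by
  rintro k ⟨p, hp⟩
  exact Multiset.zero_ne_cons hp

/-! ### Steps of the algorithm -/

theorem step_alpha {p : Part} (hp : p ∈ lhsα) (g : Game) : Step (p ::ₘ g) g :=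
  ⟨[], _, _, rfl, ⟨p, hp, g, rfl, (zero_add g).symm⟩, by simp⟩

theorem step_neg_alpha {p : Part} (hp : p ∈ lhsα.map (fun q => -q)) (hp' : p ∉ lhsα) {g : Game}
    (hg : ∀ q ∈ g, q ∉ lhsα) : Step (p ::ₘ g) g := by
  refine ⟨[Replace lhsα 0], _, _, rfl, ⟨p, hp, g, rfl, (zero_add g).symm⟩, ?_⟩
  intro R hR k
  rw [List.mem_singleton] at hR
  subst hR
  refine not_replace (fun q hq => ?_) k
  rcases Multiset.mem_cons.1 hq with rfl | hq
  exacts [hp', hg q hq]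

theorem step_cancel {p : Part} {g : Game} (h : ∀ q ∈ p ::ₘ -p ::ₘ g, q ∈ setK) :
    Step (p ::ₘ -p ::ₘ g) g := by
  refine ⟨[Replace lhsα 0, ReplaceNeg lhsα 0], Cancel, _, rfl, ⟨p, rfl⟩, ?_⟩
  intro R hR k
  have key := not_replace_of_K h (lhs := lhsα) (by decide) 0 k
  rcases List.mem_pair.1 hR with rfl | rfl
  exacts [key.1, key.2]

/-- The fragment `ooxo` matches no replacement rule before η, and it cannot cancel because its
negative is outside `K`. So η is the first applicable rule. -/
theorem step_eta {g : Game} (hg : ∀ p ∈ g, p ∈ setK) (hc : NoCancel g) :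
    Step (ooPart 4 ::ₘ g) (xxo ::ₘ altPart 2 ::ₘ g) := by
  have hc' : NoCancel (ooPart 4 ::ₘ g) :=
    hc.cons fun h => neg_ooPart_notMem_setK (by omega) (hg _ h)
  -- Twelve rules precede η, with the self-negative rule β counted twice.
  refine ⟨rules.take 12, _, _, rfl, ⟨ooPart 4, List.mem_singleton_self _, g, rfl, by
    rw [Multiset.insert_eq_cons, Multiset.cons_add, Multiset.singleton_add]; rfl⟩, ?_⟩
  intro R hR k
  have key : ∀ lhs ⊆ allLhs, ooPart 4 ∉ lhs → ooPart 4 ∉ lhs.map (fun q => -q) →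
      ∀ rhs, ¬ Replace lhs rhs (ooPart 4 ::ₘ g) k ∧
        ¬ ReplaceNeg lhs rhs (ooPart 4 ::ₘ g) k := fun lhs hl h1 h2 rhs =>
    ⟨not_replace (fun q hq => (Multiset.mem_cons.1 hq).elim (fun e => e ▸ h1)
      fun hq => (notMem_lhs (hg q hq) hl).1) k,
    not_replace (fun q hq => (Multiset.mem_cons.1 hq).elim (fun e => e ▸ h2)
      fun hq => (notMem_lhs (hg q hq) hl).2) k⟩
  simp only [rules, List.take_succ_cons, List.take_zero, List.mem_cons, List.not_mem_nil,
    or_false] at hR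
  rcases hR with rfl | rfl | rfl | rfl | rfl | rfl | rfl | rfl | rfl | rfl | rfl | rfl
  · exact (key lhsα (by decide) (by decide) (by decide) _).1
  · exact (key lhsα (by decide) (by decide) (by decide) _).2
  · exact hc' k
  · exact hc' k
  · exact (key lhsγ (by decide) (by decide) (by decide) _).1
  · exact (key lhsγ (by decide) (by decide) (by decide) _).2
  · exact (key lhsδ (by decide) (by decide) (by decide) _).1
  · exact (key lhsδ (by decide) (by decide) (by decide) _).2
  · exact (key lhsε (by decide) (by decide) (by decide) _).1
  · exact (key lhsε (by decide) (by decide) (by decide) _).2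
  · exact (key lhsζ (by decide) (by decide) (by decide) _).1
  · exact (key lhsζ (by decide) (by decide) (by decide) _).2

theorem step_neg_eta {g : Game} (hg : ∀ p ∈ g, p ∈ setK) (hc : NoCancel g) :
    Step (-ooPart 4 ::ₘ g) (ooPart 3 ::ₘ altPart 2 ::ₘ g) := by
  have h4 : ooPart 4 ∉ setK := by simp [ooPart_mem_setK]
  have hc' : NoCancel (-ooPart 4 ::ₘ g) :=
    hc.cons fun h => h4 (by simpa [neg_neg_part] using hg _ h)
  refine ⟨rules.take 13, _, _, rfl, ⟨-ooPart 4, List.mem_singleton_self _, g, rfl, ?_⟩, ?_⟩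
  · have h1 : -part [x, x, o] = ooPart 3 := by decide
    have h2 : -part [o, x] = altPart 2 := by decide
    simp [Game.negate, h1, h2]
  intro R hR k
  have key : ∀ lhs ⊆ allLhs, -ooPart 4 ∉ lhs → -ooPart 4 ∉ lhs.map (fun q => -q) →
      ∀ rhs, ¬ Replace lhs rhs (-ooPart 4 ::ₘ g) k ∧
        ¬ ReplaceNeg lhs rhs (-ooPart 4 ::ₘ g) k := fun lhs hl h1 h2 rhs =>
    ⟨not_replace (fun q hq => (Multiset.mem_cons.1 hq).elim (fun e => e ▸ h1)
      fun hq => (notMem_lhs (hg q hq) hl).1) k,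
    not_replace (fun q hq => (Multiset.mem_cons.1 hq).elim (fun e => e ▸ h2)
      fun hq => (notMem_lhs (hg q hq) hl).2) k⟩
  simp only [rules, List.take_succ_cons, List.take_zero, List.mem_cons, List.not_mem_nil,
    or_false] at hR
  rcases hR with rfl | rfl | rfl | rfl | rfl | rfl | rfl | rfl | rfl | rfl | rfl | rfl | rfl
  · exact (key lhsα (by decide) (by decide) (by decide) _).1
  · exact (key lhsα (by decide) (by decide) (by decide) _).2
  · exact hc' k
  · exact hc' k
  · exact (key lhsγ (by decide) (by decide) (by decide) _).1
  · exact (key lhsγ (by decide) (by decide) (by decide) _).2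
  · exact (key lhsδ (by decide) (by decide) (by decide) _).1
  · exact (key lhsδ (by decide) (by decide) (by decide) _).2
  · exact (key lhsε (by decide) (by decide) (by decide) _).1
  · exact (key lhsε (by decide) (by decide) (by decide) _).2
  · exact (key lhsζ (by decide) (by decide) (by decide) _).1
  · exact (key lhsζ (by decide) (by decide) (by decide) _).2
  -- One more rule than for η has to be excluded, namely η itself: `xxox` is not `ooxo`.
  · exact not_replace (fun q hq => (Multiset.mem_cons.1 hq).elim (fun e => e ▸ by decide)
      fun hq => (notMem_lhs (hg q hq) (show lhsη ⊆ allLhs by decide)).1) k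

theorem ASF.of_step {g h k : Game} (h1 : Step g h) (h2 : ASF h k) : ASF g k :=
  ⟨h2.1.head h1, h2.2⟩

theorem asf_self {g : Game} (hg : ∀ p ∈ g, p ∈ setK) (hc : NoCancel g) : ASF g g :=
  ⟨Relation.ReflTransGen.refl, isStandardForm_of_K hg hc⟩

theorem asf_cons_alpha {p : Part} (hp : p ∈ lhsα) {g h : Game} (hg : ASF g h) :
    ASF (p ::ₘ g) h := hg.of_step (step_alpha hp g)

theorem asf_cons_neg_alpha {p : Part} (hp : p ∈ lhsα.map (fun q => -q)) (hp' : p ∉ lhsα)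
    {g h : Game} (hK : ∀ q ∈ g, q ∈ setK) (hg : ASF g h) : ASF (p ::ₘ g) h :=
  hg.of_step (step_neg_alpha hp hp' fun q hq => (notMem_lhs (hK q hq) lhsα_subset).1)

/-- The algorithm removes pairs `p`, `-p` from a game with parts in `K`. -/
theorem exists_asf {g : Game} (hg : ∀ p ∈ g, p ∈ setK) :
    ∃ h m : Game, ASF g h ∧ NoCancel h ∧ g = h + (m + m.negate) := by
  by_cases hc : NoCancel g
  · exact ⟨g, 0, asf_self hg hc, hc, by simp [Game.negate]⟩
  · simp only [NoCancel, not_forall, not_not] at hc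
    obtain ⟨k, p, rfl⟩ := hc
    obtain ⟨h, m, h1, h2, rfl⟩ := exists_asf (g := k) fun q hq => hg q (by simp [hq])
    exact ⟨h, p ::ₘ m, h1.of_step (step_cancel hg), h2, by
      simp only [Game.negate, Multiset.map_cons, Multiset.cons_add, Multiset.add_cons]
      rw [Multiset.cons_swap]⟩
termination_by g.card

/-! ### Counting parts -/

theorem count_cons_of_mem {P : Set Part} {p : Part} (h : p ∈ P) (g : Game) :
    count P (p ::ₘ g) = count P g + 1 := by
  classical
  exact Multiset.countP_cons_of_pos _ h

theorem count_cons_of_notMem {P : Set Part} {p : Part} (h : p ∉ P) (g : Game) :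
    count P (p ::ₘ g) = count P g := by
  classical
  exact Multiset.countP_cons_of_neg _ h

theorem count_zero (P : Set Part) : count P 0 = 0 := by
  classical
  exact Multiset.countP_zero _

theorem count_add (P : Set Part) (g h : Game) : count P (g + h) = count P g + count P h := by
  classical
  exact Multiset.countP_add _ _ _

theorem count_eq_zero {P : Set Part} {g : Game} : count P g = 0 ↔ ∀ p ∈ g, p ∉ P := by
  classical
  exact Multiset.countP_eq_zero

theorem exists_of_count_pos {P : Set Part} {g : Game} (h : 0 < count P g) :
    ∃ p r, p ∈ P ∧ g = p ::ₘ r := by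
  classical
  obtain ⟨p, hp, hP⟩ := Multiset.countP_pos.1 h
  obtain ⟨r, rfl⟩ := Multiset.exists_cons_of_mem hp
  exact ⟨p, r, hP, rfl⟩

theorem count_singleton_of_mem {P : Set Part} {p : Part} (h : p ∈ P) :
    count P {p} = 1 := by
  rw [← Multiset.cons_zero, count_cons_of_mem h, count_zero]

theorem count_singleton_of_notMem {P : Set Part} {p : Part} (h : p ∉ P) :
    count P {p} = 0 := by
  rw [← Multiset.cons_zero, count_cons_of_notMem h, count_zero]

theorem notMem_setO'_of_neg_mem_setK {p : Part} (h : -p ∈ setK) : p ∉ setO' := by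
  rintro ⟨n, hn, -, rfl⟩
  exact neg_altPart_notMem_setK hn h

/-- A part of 𝒪' has its negative outside `K`, so it never belongs to a cancelled pair. -/
theorem count_setO'_eq_of_cancel {h m : Game} (hK : ∀ p ∈ h + (m + m.negate), p ∈ setK) :
    count setO' (h + (m + m.negate)) = count setO' h := by
  have h1 : count setO' m = 0 := count_eq_zero.2 fun p hp =>
    notMem_setO'_of_neg_mem_setK (hK _ (by
      simp only [Game.negate, Multiset.mem_add, Multiset.mem_map]; exact Or.inr (Or.inr ⟨p, hp, rfl⟩)))
  have h2 : count setO' m.negate = 0 := count_eq_zero.2 fun q hq => by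
    obtain ⟨p, hp, rfl⟩ := Multiset.mem_map.1 hq
    refine notMem_setO'_of_neg_mem_setK ?_
    rw [neg_neg_part]
    exact hK _ (by simp [hp])
  rw [count_add, count_add, h1, h2]
  rfl

theorem count_le_of_add (P : Set Part) (h m : Game) : count P h ≤ count P (h + m) := by
  rw [count_add]; omega

/-! ### Membership in the exceptional set -/

/-- Together with `exists_of_mem_setQ`, this gives two cheap ways to see that a game avoids `Q`: it
has two parts of 𝒪', or a part that occurs in no game of `Q`. -/
theorem count_setO'_of_mem_setQ {q : Game} (hq : q ∈ setQ) : count setO' q = 1 := by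
  have h5 : altPart 5 ∈ setO' := by simp [Nat.odd_iff]
  have h7 : altPart 7 ∈ setO' := by simp [Nat.odd_iff]
  have h15 : altPart 15 ∈ setO' := by simp [Nat.odd_iff]
  have h2 : altPart 2 ∉ setO' := by simp
  have h4 : altPart 4 ∉ setO' := by simp
  rcases hq with rfl | rfl | rfl
  · rw [Multiset.insert_eq_cons, count_cons_of_mem h5, count_singleton_of_notMem h2]
  · rw [Multiset.insert_eq_cons, count_cons_of_mem h7, count_singleton_of_notMem h4]
  · rw [Multiset.insert_eq_cons, Multiset.insert_eq_cons, count_cons_of_mem h15,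
      count_cons_of_notMem h4, count_singleton_of_notMem h2]

theorem exists_of_mem_setQ {q : Game} (hq : q ∈ setQ) {p : Part} (hp : p ∈ q) :
    p = altPart 2 ∨ p = altPart 4 ∨ p = altPart 5 ∨ p = altPart 7 ∨ p = altPart 15 := by
  rcases hq with rfl | rfl | rfl <;>
  · simp only [Multiset.insert_eq_cons, Multiset.mem_cons, Multiset.mem_singleton] at hp
    tauto

theorem cons_altPart_odd_mem_setQ {k : ℕ} (hk : Odd k) {r : Game} (h : altPart k ::ₘ r ∈ setQ) :
    (k = 5 ∧ r = {altPart 2}) ∨ (k = 7 ∧ r = {altPart 4}) ∨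
      (k = 15 ∧ r = {altPart 4, altPart 2}) := by
  have h2 : k ≠ 2 := by rintro rfl; exact absurd hk (by decide)
  have h4 : k ≠ 4 := by rintro rfl; exact absurd hk (by decide)
  have aux : ∀ (n : ℕ) (s : Game), (∀ p ∈ s, p = altPart 2 ∨ p = altPart 4) →
      altPart k ::ₘ r = altPart n ::ₘ s → k = n ∧ r = s := fun n s hs e => by
    rcases Multiset.cons_eq_cons.1 e with ⟨h1, h2⟩ | ⟨-, c, -, rfl⟩
    · exact ⟨altPart_injective h1, h2⟩
    · rcases hs _ (Multiset.mem_cons_self _ _) with h | h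
      · exact absurd (altPart_injective h) h2
      · exact absurd (altPart_injective h) h4
  rcases h with h | h | h
  · exact Or.inl (aux 5 {altPart 2} (by simp) h)
  · exact Or.inr (Or.inl (aux 7 {altPart 4} (by simp) h))
  · exact Or.inr (Or.inr (aux 15 {altPart 4, altPart 2} (by simp) h))

theorem cons_altPart_two_mem_setQ {r : Game} (h : altPart 2 ::ₘ r ∈ setQ) :
    r = {altPart 5} ∨ r = {altPart 15, altPart 4} := by
  rcases h with h | h | h
  · left
    exact (Multiset.cons_inj_right (altPart 2)).1 (h.trans (Multiset.cons_swap _ _ _))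
  · have := (h ▸ Multiset.mem_cons_self _ _ : altPart 2 ∈ ({altPart 7, altPart 4} : Game))
    simp at this
  · right
    refine (Multiset.cons_inj_right (altPart 2)).1 (h.trans ?_)
    change altPart 15 ::ₘ altPart 4 ::ₘ altPart 2 ::ₘ 0 = altPart 2 ::ₘ altPart 15 ::ₘ altPart 4 ::ₘ 0
    rw [Multiset.cons_swap (altPart 4), Multiset.cons_swap (altPart 15)]

/-- A part lost by cancellation has its negative in the game, so a part without its negative
survives. -/
theorem mem_of_neg_notMem {g h m : Game} (e : g = h + (m + m.negate)) {w : Part} (hw : w ∈ g)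
    (hn : -w ∉ g) : w ∈ h := by
  subst e
  simp only [Multiset.mem_add, Game.negate, Multiset.mem_map] at hw hn
  rcases hw with hw | hw | ⟨q, hq, rfl⟩
  · exact hw
  · exact absurd (Or.inr (Or.inr ⟨w, hw, rfl⟩)) hn
  · rw [neg_neg_part] at hn
    exact absurd (Or.inr (Or.inl hq)) hn

theorem mem_S1 {g : Game} (hK : ∀ p ∈ g, p ∈ setK) (hn : NoCancel g) (hy : count setA' g = 0)
    (hz : count setoA' g = 0) (hc : count setoOo' g + 1 ≤ count setO' g) (hQ : g ∉ setQ) :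
    g ∈ S1 := by
  refine ⟨⟨?_, isStandardForm_of_K hK hn, hK⟩, hy, hz, hc, hQ⟩
  rintro rfl
  rw [count_zero setO'] at hc
  omega

/-- Cancellation keeps `a` and can only lower the other counts, so the inequalities pass to the
standard form. The hypothesis `hw` keeps it out of `Q`, whichever pairs cancel. -/
theorem exists_asf_mem_S1 {g : Game} (hK : ∀ p ∈ g, p ∈ setK) (hy : count setA' g = 0)
    (hz : count setoA' g = 0) (hc : count setoOo' g + 1 ≤ count setO' g)
    (hw : 2 ≤ count setO' g ∨ ∃ w ∈ g, -w ∉ g ∧ w ≠ altPart 2 ∧ w ≠ altPart 4 ∧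
      w ≠ altPart 5 ∧ w ≠ altPart 7 ∧ w ≠ altPart 15) :
    ∃ h, ASF g h ∧ h ∈ S1 := by
  obtain ⟨h, m, h1, h2, h3⟩ := exists_asf hK
  have hO : count setO' g = count setO' h := by
    subst h3; exact count_setO'_eq_of_cancel hK
  have hle := fun P => h3 ▸ count_le_of_add P h (m + m.negate)
  refine ⟨h, h1, mem_S1 (fun p hp => hK p (by rw [h3]; simp [hp])) h2 ?_ ?_ ?_ fun hQ => ?_⟩
  · have := hle setA'; omega
  · have := hle setoA'; omega
  · have := hle setoOo'; omega
  · rcases hw with hw | ⟨w, hw, hn, hw'⟩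
    · have := count_setO'_of_mem_setQ hQ; omega
    · have := exists_of_mem_setQ hQ (mem_of_neg_notMem h3 hw hn)
      tauto

theorem mem_S2 {g : Game} (h0 : g ≠ 0) (hn : NoCancel g) (hK : ∀ p ∈ g, p ∈ setI ∨ p = xxo)
    (he : 1 ≤ count {xxo} g) (hd : count setI g = 0 ∨ 3 ≤ count setI g + count {xxo} g) :
    g ∈ S2 := by
  have hK' : ∀ p ∈ g, p ∈ setK := fun p hp => by
    rcases hK p hp with h | rfl
    · exact Or.inl (Or.inl (Or.inl (Or.inl (Or.inr h))))
    · exact xxo_mem_setK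
  have aux : ∀ p ∈ g, p = altPart 2 ∨ p = altPart 4 ∨ p = ooPart 6 ∨ p = xxo := fun p hp => by
    rcases hK p hp with (h | h | h) | h <;> tauto
  have key : ∀ P : Set Part, altPart 2 ∉ P → altPart 4 ∉ P → ooPart 6 ∉ P → xxo ∉ P →
      count P g = 0 := fun P h1 h2 h3 h4 => count_eq_zero.2 fun p hp => by
    rcases aux p hp with rfl | rfl | rfl | rfl <;> assumption
  refine ⟨⟨h0, isStandardForm_of_K hK' hn, hK'⟩, ?_, ?_, ?_, ?_, ?_, he, hd⟩
  · exact key setA' (by simp) (by simp) (ooPart_notMem_setA' (by omega)) (by simp)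
  · exact key setoA' (by simp) (by simp) (by simp [ooPart_mem_setoA']) (by simp)
  · exact key setO' (by simp) (by simp) (ooPart_notMem_setO' (by omega)) (by simp)
  · exact key setoO' (by simp) (by simp) (by simp [ooPart_mem_setoO']) (by simp)
  · exact key setoOo' (by simp) (by simp) (by simp [ooPart_mem_setoOo']) (by simp)

/-! ### Moves of Left -/

theorem move_right {u v : List Stone} {p a b : Part} (hp : p = part (u ++ x :: o :: v))
    (ha : row u = {a}) (hb : row (x :: v) = {b}) (r : Game) :
    Move x (p ::ₘ r) (a ::ₘ b ::ₘ r) :=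
  ⟨_, _, r, RowMove.clobberRight u v, by rw [hp]; rfl, by
    rw [ha, hb, add_assoc, Multiset.singleton_add, Multiset.singleton_add]⟩

theorem move_left {u v : List Stone} {p a b : Part} (hp : p = part (u ++ o :: x :: v))
    (ha : row (u ++ [x]) = {a}) (hb : row v = {b}) (r : Game) :
    Move x (p ::ₘ r) (a ::ₘ b ::ₘ r) :=
  ⟨_, _, r, RowMove.clobberLeft u v, by rw [hp]; rfl, by
    rw [ha, hb, add_assoc, Multiset.singleton_add, Multiset.singleton_add]⟩

theorem move_left_end {u : List Stone} {p a : Part} (hp : p = part (u ++ [o, x]))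
    (ha : row (u ++ [x]) = {a}) (r : Game) : Move x (p ::ₘ r) (a ::ₘ r) :=
  ⟨_, _, r, RowMove.clobberLeft u [], by rw [hp]; rfl, by
    rw [ha, row, add_zero, Multiset.singleton_add]⟩

theorem row_eq {l : List Stone} (h : l ≠ []) : row l = {part l} := by
  cases l with
  | nil => exact absurd rfl h
  | cons s l => rfl

theorem row_alt {n : ℕ} (hn : 0 < n) : row (alt o n) = {altPart n} := by
  obtain ⟨k, rfl⟩ := Nat.exists_eq_add_of_le' hn
  rfl

theorem move_altPart_three {n : ℕ} (hn : Odd n) (r : Game) :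
    Move x (altPart (n + 3) ::ₘ r) (altPart n ::ₘ part [x, x] ::ₘ r) :=
  move_right (u := alt o n) (v := [x]) (by rw [altPart, alt_add_of_odd o hn]; rfl)
    (row_alt hn.pos) rfl r

theorem move_ooPart_three {n : ℕ} (hn : Even n) (hn' : 2 ≤ n) (r : Game) :
    Move x (ooPart (n + 3) ::ₘ r) (ooPart n ::ₘ part [x, x] ::ₘ r) := by
  obtain ⟨k, rfl⟩ := Nat.exists_eq_add_of_le' hn'
  have hk : Odd (k + 1) := by
    obtain ⟨m, hm⟩ := hn; exact ⟨m - 1, by omega⟩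
  refine move_right (u := o :: alt o (k + 1)) (v := [x]) ?_ rfl rfl r
  rw [ooPart, show k + 2 + 3 - 1 = k + 1 + 3 by omega, alt_add_of_odd o hk]
  rfl

theorem move_ooPartoo {n : ℕ} (hn : Even n) (hn' : 2 ≤ n) (r : Game) :
    Move x (ooPartoo (n + 3) ::ₘ r) (altPart 2 ::ₘ ooPart n ::ₘ r) := by
  obtain ⟨k, rfl⟩ := Nat.exists_eq_add_of_le' hn'
  have hk : Odd (k + 1) := by
    obtain ⟨m, hm⟩ := hn; exact ⟨m - 1, by omega⟩
  refine move_left (u := [o]) (v := alt o (k + 1) ++ [o]) rfl rfl ?_ r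
  -- Read from its other end, the remaining row starts with the final `oo`.
  rw [row_eq (by simp), ← part_reverse, List.reverse_append, reverse_alt_of_odd o hk]
  rfl

theorem move_altPart_two {n : ℕ} (hn : 0 < n) (r : Game) :
    Move x (altPart (n + 2) ::ₘ r) (part [x] ::ₘ altPart n ::ₘ r) :=
  move_left (u := []) (v := alt o n) rfl rfl (row_alt hn) r

theorem move_altPart_four {n : ℕ} (hn : 0 < n) (r : Game) :
    Move x (altPart (n + 4) ::ₘ r) (xxo ::ₘ altPart n ::ₘ r) :=
  move_left (u := [o, x]) (v := alt o n) rfl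
    (congrArg (fun p : Part => ({p} : Game)) (part_reverse [x, x, o])) (row_alt hn) r

theorem move_ooPart_alt {n : ℕ} (hn : 0 < n) (r : Game) :
    Move x (ooPart (n + 3) ::ₘ r) (altPart 2 ::ₘ altPart n ::ₘ r) :=
  move_left (u := [o]) (v := alt o n) rfl rfl (row_alt hn) r

theorem move_ooPart_five {n : ℕ} (hn : 0 < n) (r : Game) :
    Move x (ooPart (n + 5) ::ₘ r) (part [o, o, x, x] ::ₘ altPart n ::ₘ r) :=
  move_left (u := [o, o, x]) (v := alt o n) rfl rfl (row_alt hn) r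

theorem move_a2 (r : Game) : Move x (altPart 2 ::ₘ r) (part [x] ::ₘ r) :=
  move_left_end (u := []) rfl rfl r

theorem move_oox (r : Game) : Move x (ooPart 3 ::ₘ r) (altPart 2 ::ₘ r) :=
  move_left_end (u := [o]) rfl rfl r

theorem move_a4 (r : Game) : Move x (altPart 4 ::ₘ r) (xxo ::ₘ r) :=
  move_left_end (u := [o, x]) rfl (congrArg (fun p : Part => ({p} : Game)) (part_reverse [x, x, o])) r

theorem move_xxo (r : Game) : Move x (xxo ::ₘ r) (part [x] ::ₘ part [x] ::ₘ r) :=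
  move_right (u := [x]) (v := []) rfl rfl rfl r

theorem move_oo6_xxo (r : Game) : Move x (ooPart 6 ::ₘ r) (part [o, o] ::ₘ xxo ::ₘ r) :=
  move_right (u := [o, o]) (v := [x, o]) rfl rfl rfl r

theorem move_oo6_oo4 (r : Game) : Move x (ooPart 6 ::ₘ r) (ooPart 4 ::ₘ part [x] ::ₘ r) :=
  move_right (u := [o, o, x, o]) (v := []) rfl rfl rfl r

theorem move_oo8 (r : Game) : Move x (ooPart 8 ::ₘ r) (ooPart 4 ::ₘ xxo ::ₘ r) :=
  move_right (u := [o, o, x, o]) (v := [x, o]) rfl rfl rfl r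

theorem move_oo12 (r : Game) : Move x (ooPart 12 ::ₘ r) (ooPart 8 ::ₘ xxo ::ₘ r) :=
  move_right (u := [o, o, x, o, x, o, x, o]) (v := [x, o]) rfl rfl rfl r

/-- The second piece is `xxox`, which rule −η turns into `oox + ox`. -/
theorem move_a10 (r : Game) : Move x (altPart 10 ::ₘ r) (altPart 5 ::ₘ -ooPart 4 ::ₘ r) :=
  move_right (u := [o, x, o, x, o]) (v := [x, o, x]) rfl rfl rfl r

/-! ### Discarding dead parts -/

theorem asf_x {g h : Game} (hK : ∀ q ∈ g, q ∈ setK) (hg : ASF g h) :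
    ASF (part [x] ::ₘ g) h :=
  asf_cons_neg_alpha (by decide) (by decide) hK hg

theorem asf_xx {g h : Game} (hK : ∀ q ∈ g, q ∈ setK) (hg : ASF g h) :
    ASF (part [x, x] ::ₘ g) h :=
  asf_cons_neg_alpha (by decide) (by decide) hK hg

theorem asf_x_x {g h : Game} (hK : ∀ q ∈ g, q ∈ setK) (hg : ASF g h) :
    ASF (part [x] ::ₘ part [x] ::ₘ g) h :=
  (asf_x hK hg).of_step (step_neg_alpha (by decide) (by decide) fun q hq => by
    rcases Multiset.mem_cons.1 hq with rfl | hq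
    · decide
    · exact (notMem_lhs (hK q hq) lhsα_subset).1)

/-! ### The winning moves -/

/-- Left can move from `g` to a game whose standard form is in `𝒮₁ ∪ 𝒮₂ ∪ LL ∪ {0}`. -/
def HasGoodMove (g : Game) : Prop :=
  ∃ h h' : Game, Move x g h ∧ ASF h h' ∧ h' ∈ S1 ∪ S2 ∪ setLL ∪ {0}

theorem HasGoodMove.of_S1 {g h h' : Game} (hm : Move x g h) (ha : ASF h h') (hs : h' ∈ S1) :
    HasGoodMove g := ⟨h, h', hm, ha, Or.inl (Or.inl (Or.inl hs))⟩

theorem HasGoodMove.of_S2 {g h h' : Game} (hm : Move x g h) (ha : ASF h h') (hs : h' ∈ S2) :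
    HasGoodMove g := ⟨h, h', hm, ha, Or.inl (Or.inl (Or.inr hs))⟩

theorem HasGoodMove.of_LL {g h h' : Game} (hm : Move x g h) (ha : ASF h h') (hs : h' ∈ setLL) :
    HasGoodMove g := ⟨h, h', hm, ha, Or.inl (Or.inr hs)⟩

theorem HasGoodMove.of_zero {g h : Game} (hm : Move x g h) (ha : ASF h 0) : HasGoodMove g :=
  ⟨h, 0, hm, ha, Or.inr rfl⟩

theorem neg_altPart_odd_notMem {k : ℕ} (hk : Odd k) {r : Game} (hK : ∀ p ∈ r, p ∈ setK) :
    -altPart k ∉ r := fun h => neg_altPart_notMem_setK hk (hK _ h)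

theorem neg_ooPart_notMem {k : ℕ} (hk : 4 ≤ k) {r : Game} (hK : ∀ p ∈ r, p ∈ setK) :
    -ooPart k ∉ r := fun h => neg_ooPart_notMem_setK hk (hK _ h)

/-- A new part of `𝒪'` brings a game with `c ≤ a` and `y = z = 0` into `𝒮₁`, outside `Q`. -/
theorem cons_altPart_odd_mem_S1 {k : ℕ} (hk : Odd k) (hk' : k = 5 ∨ k = 7 ∨ 11 ≤ k) {r : Game}
    (hK : ∀ p ∈ r, p ∈ setK) (hn : NoCancel r) (hy : count setA' r = 0)
    (hz : count setoA' r = 0) (hc : count setoOo' r ≤ count setO' r)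
    (hQ : altPart k ::ₘ r ∉ setQ) :
    ASF (altPart k ::ₘ r) (altPart k ::ₘ r) ∧ altPart k ::ₘ r ∈ S1 := by
  have hK' : ∀ p ∈ altPart k ::ₘ r, p ∈ setK := by
    rw [Multiset.forall_mem_cons]
    exact ⟨by rw [altPart_mem_setK]; obtain ⟨m, rfl⟩ := hk; omega, hK⟩
  have hn' := hn.cons (neg_altPart_odd_notMem hk hK)
  have he : ¬ Even k := Nat.not_even_iff_odd.2 hk
  refine ⟨asf_self hK' hn', mem_S1 hK' hn' ?_ ?_ ?_ hQ⟩
  · rwa [count_cons_of_notMem (by simp [he])]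
  · rwa [count_cons_of_notMem (by simp)]
  · rw [count_cons_of_notMem (by simp), count_cons_of_mem (by simp [hk, hk'])]
    omega

/-- The move a(n) → o(n−3) + xx trades the part of 𝒜' for one of 𝒪': the lengths 8, 10, ≥ 14 become
5, 7, ≥ 11. Only the three games that would land in `Q` need another move. -/
theorem hasGoodMove_of_A' {n : ℕ} (hn : Even n) (hn' : n = 8 ∨ n = 10 ∨ 14 ≤ n) {r : Game}
    (hK : ∀ p ∈ r, p ∈ setK) (hr : NoCancel r) (hy : count setA' r = 0)
    (hz : count setoA' r = 0) (hc : count setoOo' r ≤ count setO' r) :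
    HasGoodMove (altPart n ::ₘ r) := by
  obtain ⟨k, rfl⟩ := Nat.exists_eq_add_of_le' (show 3 ≤ n by omega)
  have hk : Odd k := by
    obtain ⟨m, hm⟩ := hn; exact ⟨m - 2, by omega⟩
  by_cases hQ : altPart k ::ₘ r ∈ setQ
  · rcases cons_altPart_odd_mem_setQ hk hQ with ⟨rfl, rfl⟩ | ⟨rfl, rfl⟩ | ⟨rfl, rfl⟩
    -- a8 + a2 → xxo + a4 + a2, which is in 𝒮₂ since d + e = 3.
    · have hN : NoCancel (xxo ::ₘ altPart 4 ::ₘ {altPart 2}) :=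
        ((noCancel_zero.cons (p := altPart 2) (by decide)).cons (by decide)).cons (by decide)
      refine .of_S2 (move_altPart_four (n := 4) (by omega) _)
        (asf_self (by simp) hN) (mem_S2 (by simp) hN (by simp) ?_ ?_)
      · simp [count_cons_of_mem]
      · simp [count_cons_of_mem, count_cons_of_notMem, count_singleton_of_mem,
          count_singleton_of_notMem]
    -- a10 + a4 → o5 + xxox + a4, whose standard form o5 + oox + a4 + a2 is in `LL`.
    · have hN : NoCancel (altPart 5 ::ₘ {altPart 4}) :=
        (noCancel_zero.cons (p := altPart 4) (by decide)).cons (by decide)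
      have hN' : NoCancel (ooPart 3 ::ₘ altPart 2 ::ₘ altPart 5 ::ₘ {altPart 4}) :=
        (hN.cons (by decide)).cons (by decide)
      refine .of_LL (move_a10 _) (h' := ooPart 3 ::ₘ altPart 2 ::ₘ altPart 5 ::ₘ {altPart 4}) ?_ ?_
      · rw [Multiset.cons_swap]
        exact .of_step (step_neg_eta (by simp) hN) (asf_self (by simp [ooPart_mem_setK]) hN')
      · refine Or.inr (Or.inr (Or.inl ?_))
        decide
    -- a18 + a4 + a2 → xxo + a14 + a4 + a2, which is in `LL`.
    · refine .of_LL (move_altPart_four (n := 14) (by omega) _)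
        (h' := xxo ::ₘ altPart 14 ::ₘ altPart 4 ::ₘ {altPart 2}) (asf_self (by simp) ?_) ?_
      · exact ((((noCancel_zero.cons (p := altPart 2) (by decide)).cons
          (by decide)).cons (by decide)).cons (by decide))
      · exact Or.inr (Or.inr (Or.inr (Multiset.cons_swap _ _ _)))
  · obtain ⟨h1, h2⟩ := cons_altPart_odd_mem_S1 hk (by omega) hK hr hy hz hc hQ
    refine .of_S1 (move_altPart_three hk r) ?_ h2
    rw [Multiset.cons_swap]
    exact asf_xx h2.1.2.2 h1

/-- The move oo(n) → oo(n−3) + xx removes the part of o𝒜' and changes neither `a` nor `c`. For n ≥ 9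
the new part is in `K` and in no game of `Q`; for n = 7 it is `ooxo`, which η replaces by `xxo +
ox`. -/
theorem hasGoodMove_of_oA' {n : ℕ} (hn : Odd n) (hn' : 7 ≤ n) {r : Game}
    (hK : ∀ p ∈ r, p ∈ setK) (hr : NoCancel r) (hy : count setA' r = 0)
    (hz : count setoA' r = 0) (hc : count setoOo' r + 1 ≤ count setO' r) :
    HasGoodMove (ooPart n ::ₘ r) := by
  obtain ⟨k, rfl⟩ := Nat.exists_eq_add_of_le' (show 3 ≤ n by omega)
  have hk : Even k := by
    obtain ⟨m, hm⟩ := hn; exact ⟨m - 1, by omega⟩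
  have hm := move_ooPart_three hk (by omega) r
  rw [Multiset.cons_swap] at hm
  rcases eq_or_ne k 4 with rfl | hk4
  · have hK' : ∀ p ∈ xxo ::ₘ altPart 2 ::ₘ r, p ∈ setK := by simpa using hK
    have hc2 : count setoOo' (xxo ::ₘ altPart 2 ::ₘ r) = count setoOo' r := by
      rw [count_cons_of_notMem (by simp), count_cons_of_notMem (by simp)]
    have hc1 : count setO' (xxo ::ₘ altPart 2 ::ₘ r) = count setO' r := by
      rw [count_cons_of_notMem (by simp), count_cons_of_notMem (by simp)]
    obtain ⟨h, h1, h2⟩ := exists_asf_mem_S1 hK' (by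
        rwa [count_cons_of_notMem (by simp), count_cons_of_notMem (by simp)]) (by
        rwa [count_cons_of_notMem (by simp), count_cons_of_notMem (by simp)]) (by omega) (by
        -- If c > 0 then a ≥ 2, which excludes `Q`. If c = 0 there is no `oox`, so `xxo` survives
        -- and excludes `Q`.
        by_cases h0 : 0 < count setoOo' r
        · left; omega
        · refine Or.inr ⟨xxo, Multiset.mem_cons_self _ _, fun h => h0 ?_, ?_⟩
          · rw [neg_xxo] at h
            have : ooPart 3 ∈ r := by
              rcases Multiset.mem_cons.1 h with h | h
              · exact absurd h (by decide)
              rcases Multiset.mem_cons.1 h with h | h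
              · exact absurd h (by decide)
              · exact h
            obtain ⟨t, rfl⟩ := Multiset.exists_cons_of_mem this
            rw [count_cons_of_mem (by simp [ooPart_mem_setoOo'])]
            omega
          · decide)
    refine .of_S1 hm ?_ h2
    exact .of_step (step_neg_alpha (by decide) (by decide) fun q hq => by
      rcases Multiset.mem_cons.1 hq with rfl | hq
      · decide
      · exact (notMem_lhs (hK q hq) lhsα_subset).1) (.of_step (step_eta hK hr) h1)
  · have hk6 : 6 ≤ k := by obtain ⟨m, hm⟩ := hk; omega
    have ho : ¬ Odd k := Nat.not_odd_iff_even.2 hk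
    have hk2 : 2 ≤ k := by omega
    have hK' : ∀ p ∈ ooPart k ::ₘ r, p ∈ setK := by
      rw [Multiset.forall_mem_cons]
      exact ⟨(ooPart_mem_setK hk2).2 (Or.inr hk6), hK⟩
    have hN := hr.cons (neg_ooPart_notMem (show 4 ≤ k by omega) hK)
    refine .of_S1 hm (asf_xx hK' (asf_self hK' hN)) (mem_S1 hK' hN ?_ ?_ ?_ fun hQ => ?_)
    · rwa [count_cons_of_notMem (ooPart_notMem_setA' hk2)]
    · rwa [count_cons_of_notMem (by simp [ooPart_mem_setoA' hk2, ho])]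
    · rwa [count_cons_of_notMem (by rw [ooPart_mem_setoOo' hk2]; omega),
        count_cons_of_notMem (ooPart_notMem_setO' hk2)]
    · rcases exists_of_mem_setQ hQ (Multiset.mem_cons_self _ _) with h | h | h | h | h <;>
        exact altPart_ne_ooPart _ hk2 h.symm

/-- The move oox → ox lowers `c`. The new `ox` cancels exactly when the rest already contains `a2`,
and each of the two outcomes may fall into `Q`. -/
theorem hasGoodMove_of_oox {r : Game} (hK : ∀ p ∈ r, p ∈ setK) (hr : NoCancel (ooPart 3 ::ₘ r))
    (hy : count setA' r = 0) (hz : count setoA' r = 0)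
    (hc : count setoOo' r + 1 ≤ count setO' r) : HasGoodMove (ooPart 3 ::ₘ r) := by
  by_cases h2 : altPart 2 ∈ r
  · obtain ⟨t, rfl⟩ := Multiset.exists_cons_of_mem h2
    have hKt : ∀ p ∈ t, p ∈ setK := fun p hp => hK p (by simp [hp])
    have hNt := hr.of_cons.of_cons
    have h2t : altPart 2 ∉ t := by
      simpa only [neg_altPart_of_even even_two] using hr.of_cons.neg_notMem
    rw [count_cons_of_notMem (by simp)] at hy hz hc
    rw [count_cons_of_notMem (by simp)] at hc
    by_cases hQ : t ∈ setQ
    -- Since `a2 ∉ t`, only o7 + a4 remains. From oox + a2 + o7 + a4, moving o7 → x + o5 reaches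
    -- `LL`.
    · rcases hQ with rfl | rfl | rfl
      · simp at h2t
      · have hN : NoCancel (altPart 5 ::ₘ ooPart 3 ::ₘ altPart 4 ::ₘ {altPart 2}) :=
          (((noCancel_zero.cons (p := altPart 2) (by decide)).cons
            (by decide)).cons (by decide)).cons (by decide)
        have e : ooPart 3 ::ₘ altPart 2 ::ₘ {altPart 7, altPart 4} =
            altPart 7 ::ₘ ooPart 3 ::ₘ altPart 4 ::ₘ {altPart 2} := by decide
        rw [e]
        refine .of_LL (move_altPart_two (n := 5) (by omega) _)
          (asf_x (by simp [ooPart_mem_setK]) (asf_self (by simp [ooPart_mem_setK]) hN)) ?_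
        exact Or.inr (Or.inr (Or.inl rfl))
      · simp at h2t
    · refine .of_S1 (move_oox _) ?_ (mem_S1 hKt hNt hy hz hc hQ)
      have hs : Step (altPart 2 ::ₘ -altPart 2 ::ₘ t) t := step_cancel (by
        simpa [neg_altPart_of_even even_two] using hKt)
      rw [neg_altPart_of_even even_two] at hs
      exact .of_step hs (asf_self hKt hNt)
  · have hN : NoCancel (altPart 2 ::ₘ r) :=
      hr.of_cons.cons (by rwa [neg_altPart_of_even even_two])
    have hK' : ∀ p ∈ altPart 2 ::ₘ r, p ∈ setK := by simpa using hK
    by_cases hQ : altPart 2 ::ₘ r ∈ setQ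
    · rcases cons_altPart_two_mem_setQ hQ with rfl | rfl
      -- o5 + oox → o + xxo + oox, which reduces to 0.
      · have e : ooPart 3 ::ₘ {altPart 5} = altPart 5 ::ₘ {ooPart 3} := by decide
        rw [e]
        refine .of_zero (move_altPart_four (n := 1) (by omega) _) ?_
        have hs : Step (xxo ::ₘ -xxo ::ₘ 0) 0 := step_cancel (by
          simp [neg_xxo, ooPart_mem_setK])
        rw [neg_xxo] at hs
        rw [Multiset.cons_swap]
        exact asf_cons_alpha (by decide) (.of_step hs (asf_self (by simp) noCancel_zero))
      -- o15 → xxo + o11, where `xxo` cancels `oox` and leaves o11 + a4 in 𝒮₁.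
      · have e : ooPart 3 ::ₘ {altPart 15, altPart 4} =
            altPart 15 ::ₘ ooPart 3 ::ₘ {altPart 4} := by decide
        rw [e]
        have h1 := cons_altPart_odd_mem_S1 (k := 11) (by decide) (by omega) (r := {altPart 4})
          (by simp) (noCancel_zero.cons (p := altPart 4) (by decide))
          (count_singleton_of_notMem (by simp)) (count_singleton_of_notMem (by simp))
          (by rw [count_singleton_of_notMem (by simp)]; omega) (fun h => by
            have := cons_altPart_odd_mem_setQ (by decide) h
            omega)
        refine .of_S1 (move_altPart_four (n := 11) (by omega) _) ?_ h1.2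
        have hs : Step (xxo ::ₘ -xxo ::ₘ altPart 11 ::ₘ {altPart 4}) (altPart 11 ::ₘ {altPart 4}) :=
          step_cancel (by simp [neg_xxo, ooPart_mem_setK])
        rw [neg_xxo] at hs
        rw [Multiset.cons_swap (altPart 11)]
        exact .of_step hs h1.1
    · refine .of_S1 (move_oox _) (asf_self hK' hN) (mem_S1 hK' hN ?_ ?_ ?_ hQ)
      · rwa [count_cons_of_notMem (by simp)]
      · rwa [count_cons_of_notMem (by simp)]
      · rwa [count_cons_of_notMem (by simp), count_cons_of_notMem (by simp)]

/-- The move oo(n)oo → ox + oo(n−3) lowers `c`. The part oo(n−3) has its negative outside `K`, so it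
survives and keeps the result out of `Q`, even if `ox` cancels. -/
theorem hasGoodMove_of_ooPartoo {n : ℕ} (hn : Odd n) (hn' : 9 ≤ n) {r : Game}
    (hK : ∀ p ∈ r, p ∈ setK) (hy : count setA' r = 0) (hz : count setoA' r = 0)
    (hc : count setoOo' r + 1 ≤ count setO' r) : HasGoodMove (ooPartoo n ::ₘ r) := by
  obtain ⟨k, rfl⟩ := Nat.exists_eq_add_of_le' (show 3 ≤ n by omega)
  have hk : Even k := by
    obtain ⟨m, hm⟩ := hn; exact ⟨m - 1, by omega⟩
  have ho : ¬ Odd k := Nat.not_odd_iff_even.2 hk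
  have hk2 : 2 ≤ k := by omega
  have hK' : ∀ p ∈ altPart 2 ::ₘ ooPart k ::ₘ r, p ∈ setK := by
    rw [Multiset.forall_mem_cons, Multiset.forall_mem_cons]
    exact ⟨by simp, (ooPart_mem_setK hk2).2 (by omega), hK⟩
  obtain ⟨h, h1, h2⟩ := exists_asf_mem_S1 hK' (by
      rwa [count_cons_of_notMem (by simp), count_cons_of_notMem (ooPart_notMem_setA' hk2)]) (by
      rwa [count_cons_of_notMem (by simp),
        count_cons_of_notMem (by simp [ooPart_mem_setoA' hk2, ho])]) (by
      rwa [count_cons_of_notMem (by simp),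
        count_cons_of_notMem (by rw [ooPart_mem_setoOo' hk2]; omega),
        count_cons_of_notMem (by simp), count_cons_of_notMem (ooPart_notMem_setO' hk2)])
      (Or.inr ⟨ooPart k, by simp, neg_ooPart_notMem (by omega) hK',
        (altPart_ne_ooPart _ hk2).symm, (altPart_ne_ooPart _ hk2).symm,
        (altPart_ne_ooPart _ hk2).symm, (altPart_ne_ooPart _ hk2).symm,
        (altPart_ne_ooPart _ hk2).symm⟩)
  exact .of_S1 (move_ooPartoo hk hk2 r) h1 h2

theorem oox_notMem {r : Game} (hc : count setoOo' r = 0) : ooPart 3 ∉ r := fun h =>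
  count_eq_zero.1 hc _ h (Or.inl rfl)

/-- With c = 0 there is no `oox` to cancel `xxo`, and no game of `Q` contains `xxo`. -/
theorem cons_xxo_mem_S1 {r : Game} (hK : ∀ p ∈ r, p ∈ setK) (hn : NoCancel r)
    (hy : count setA' r = 0) (hz : count setoA' r = 0) (hc : count setoOo' r = 0)
    (ha : 1 ≤ count setO' r) : ASF (xxo ::ₘ r) (xxo ::ₘ r) ∧ xxo ::ₘ r ∈ S1 := by
  have hK' : ∀ p ∈ xxo ::ₘ r, p ∈ setK := by simpa using hK
  have hn' : NoCancel (xxo ::ₘ r) := hn.cons (by rw [neg_xxo]; exact oox_notMem hc)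
  refine ⟨asf_self hK' hn', mem_S1 hK' hn' ?_ ?_ ?_ fun hQ => ?_⟩
  · rwa [count_cons_of_notMem (by simp)]
  · rwa [count_cons_of_notMem (by simp)]
  · rw [count_cons_of_notMem (by simp), count_cons_of_notMem (by simp)]
    omega
  · rcases exists_of_mem_setQ hQ (Multiset.mem_cons_self _ _) with h | h | h | h | h <;>
      exact altPart_ne_xxo _ h.symm

theorem singleton_altPart_mem_S1 {k : ℕ} (hk : Odd k) (hk' : k = 5 ∨ k = 7 ∨ 11 ≤ k) :
    ASF {altPart k} {altPart k} ∧ {altPart k} ∈ S1 := by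
  refine cons_altPart_odd_mem_S1 (r := 0) hk hk' (by simp) noCancel_zero (count_zero _)
    (count_zero _) (by rw [count_zero]; omega) fun h => ?_
  rcases cons_altPart_odd_mem_setQ hk h with h | h | h <;>
    exact absurd h.2.symm (Multiset.cons_ne_zero)

/-! ### Games with all parts in 𝓘 ∪ {xxo}, and games with parts of 𝒪', o𝒪' or `oo8` -/

theorem eq_zero_of_counts {r : Game} (hr : ∀ p ∈ r, p ∈ setI ∨ p = xxo) (hd : count setI r = 0)
    (he : count {xxo} r = 0) : r = 0 :=
  Multiset.eq_zero_of_forall_notMem fun p hp =>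
    (hr p hp).elim (count_eq_zero.1 hd p hp) (count_eq_zero.1 he p hp)

theorem mem_setK_of_I {r : Game} (hr : ∀ p ∈ r, p ∈ setI ∨ p = xxo) : ∀ p ∈ r, p ∈ setK :=
  fun p hp => by
    rcases hr p hp with h | rfl
    · exact Or.inl (Or.inl (Or.inl (Or.inl (Or.inr h))))
    · exact xxo_mem_setK

theorem mem_I_or_xxo {g : Game} (hK : ∀ p ∈ g, p ∈ setK) (ha : count setO' g = 0)
    (hb : count setoO' g = 0) (hc : count setoOo' g = 0) (hf : ooPart 8 ∉ g)
    (hy : count setA' g = 0) (hz : count setoA' g = 0) : ∀ p ∈ g, p ∈ setI ∨ p = xxo := by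
  intro p hp
  rcases hK p hp with ((((((h | h) | h) | h) | h) | h) | h) | h
  · exact absurd h (count_eq_zero.1 ha p hp)
  · exact absurd h (count_eq_zero.1 hb p hp)
  · exact absurd h (count_eq_zero.1 hc p hp)
  · exact Or.inl h
  · exact Or.inr h
  · exact absurd (h ▸ hp) hf
  · exact absurd h (count_eq_zero.1 hy p hp)
  · exact absurd h (count_eq_zero.1 hz p hp)

theorem oox_notMem_of_I {r : Game} (hr : ∀ p ∈ r, p ∈ setI ∨ p = xxo) : ooPart 3 ∉ r := fun h => by
  rcases hr _ h with h | h
  · rw [ooPart_mem_setI (by omega)] at h; omega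
  · exact ooPart_ne_xxo (by omega) h

theorem count_setI_cons_xxo (r : Game) : count setI (xxo ::ₘ r) = count setI r :=
  count_cons_of_notMem (by simp) r

theorem count_xxo_cons_xxo (r : Game) : count {xxo} (xxo ::ₘ r) = count {xxo} r + 1 :=
  count_cons_of_mem (by simp) r

theorem count_xxo_cons_of_mem_setI {p : Part} (hp : p ∈ setI) (r : Game) :
    count {xxo} (p ::ₘ r) = count {xxo} r := by
  refine count_cons_of_notMem ?_ r
  rintro rfl
  exact xxo_notMem_setI hp

theorem cons_xxo_mem_S2 {r : Game} (hr : ∀ p ∈ r, p ∈ setI ∨ p = xxo) (hn : NoCancel r)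
    (hd : count setI r = 0 ∨ 2 ≤ count setI r + count {xxo} r) :
    ASF (xxo ::ₘ r) (xxo ::ₘ r) ∧ xxo ::ₘ r ∈ S2 := by
  have hn' : NoCancel (xxo ::ₘ r) := hn.cons (by rw [neg_xxo]; exact oox_notMem_of_I hr)
  refine ⟨asf_self (by simpa using mem_setK_of_I hr) hn',
    mem_S2 (Multiset.cons_ne_zero) hn' (by simpa using hr) ?_ ?_⟩
  · rw [count_xxo_cons_xxo]; omega
  · rw [count_xxo_cons_xxo, count_setI_cons_xxo]; omega

/-- The move o5 → o + xxo loses the part of 𝒪', so it suits only when another such part is left or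
when the rest leads to 𝒮₂. Otherwise Left keeps `o5` and plays elsewhere. -/
theorem hasGoodMove_of_O'_five {r : Game} (hK : ∀ p ∈ r, p ∈ setK) (hr : NoCancel r)
    (hy : count setA' r = 0) (hz : count setoA' r = 0) (hc : count setoOo' r = 0) :
    HasGoodMove (altPart 5 ::ₘ r) := by
  have hm := move_altPart_four (n := 1) (by omega) r
  rw [Multiset.cons_swap] at hm
  have hα : altPart 1 ∈ lhsα := by decide
  have h5 : altPart 5 ∈ setO' := by simp [Nat.odd_iff]
  by_cases ha : 1 ≤ count setO' r
  · obtain ⟨h1, h2⟩ := cons_xxo_mem_S1 hK hr hy hz hc ha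
    exact .of_S1 hm (asf_cons_alpha hα h1) h2
  -- Moving in oo(m) produces a second part of 𝒪' beside `o5`, and two such parts exclude `Q`.
  by_cases hb : ∃ m, Even m ∧ 8 ≤ m ∧ ooPart m ∈ r
  · obtain ⟨m, hme, hm8, hmr⟩ := hb
    obtain ⟨t, rfl⟩ := Multiset.exists_cons_of_mem hmr
    have hm2 : 2 ≤ m := by omega
    have hmo : ¬ Odd m := Nat.not_odd_iff_even.2 hme
    rw [count_cons_of_notMem (ooPart_notMem_setA' hm2)] at hy
    rw [count_cons_of_notMem (by simp [ooPart_mem_setoA' hm2, hmo])] at hz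
    rw [count_cons_of_notMem (by rw [ooPart_mem_setoOo' hm2]; omega)] at hc
    rw [Multiset.cons_swap]
    obtain ⟨k, rfl⟩ := Nat.exists_eq_add_of_le' (show 3 ≤ m by omega)
    have hk : Odd k := by obtain ⟨j, hj⟩ := hme; exact ⟨j - 2, by omega⟩
    have hKt : ∀ p ∈ t, p ∈ setK := fun p hp => hK p (by simp [hp])
    have aux : ∀ (s : Game) (j : ℕ), Odd j → (j = 5 ∨ j = 7 ∨ 11 ≤ j) →
        (s = 0 ∨ s = {altPart 2}) → ∃ h, ASF (s + altPart j ::ₘ altPart 5 ::ₘ t) h ∧ h ∈ S1 := by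
      intro s j hj hj' hs
      have hje : ¬ Even j := Nat.not_even_iff_odd.2 hj
      have hcs : ∀ P : Set Part, altPart 2 ∉ P → count P s = 0 := fun P hP => by
        rcases hs with rfl | rfl
        · exact count_zero P
        · exact count_singleton_of_notMem hP
      refine exists_asf_mem_S1 ?_ ?_ ?_ ?_ (Or.inl ?_)
      · intro p hp
        rcases Multiset.mem_add.1 hp with hp | hp
        · rcases hs with rfl | rfl
          · simp at hp
          · rw [Multiset.mem_singleton.1 hp]; simp
        · rcases Multiset.mem_cons.1 hp with rfl | hp
          · rw [altPart_mem_setK]; obtain ⟨i, rfl⟩ := hj; omega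
          · rcases Multiset.mem_cons.1 hp with rfl | hp
            · simp
            · exact hKt p hp
      · rw [count_add, hcs _ (by simp), count_cons_of_notMem (by simp [hje]),
          count_cons_of_notMem (by simp), hy]
      · rw [count_add, hcs _ (by simp), count_cons_of_notMem (by simp),
          count_cons_of_notMem (by simp), hz]
      · rw [count_add, count_add, hcs _ (by simp), count_cons_of_notMem (by simp),
          count_cons_of_notMem (by simp), count_cons_of_mem (by simp [hj, hj']),
          count_cons_of_mem h5]
        omega
      · rw [count_add, count_cons_of_mem (by simp [hj, hj']), count_cons_of_mem h5]
        omega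
    -- oo12 would give `o9`, which is not in 𝒪'; the move oo12 → ooxx + o7 avoids it.
    rcases eq_or_ne k 9 with rfl | hk9
    · obtain ⟨h, h1, h2⟩ := aux 0 7 (by decide) (by omega) (Or.inl rfl)
      rw [zero_add] at h1
      exact .of_S1 (move_ooPart_five (n := 7) (by omega) _) (asf_cons_alpha (by decide) h1) h2
    · obtain ⟨h, h1, h2⟩ := aux {altPart 2} k hk (by obtain ⟨i, rfl⟩ := hk; omega) (Or.inr rfl)
      exact .of_S1 (move_ooPart_alt hk.pos _) h1 h2
  have hI := mem_I_or_xxo hK (by omega) (count_eq_zero.2 (by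
    rintro p hp ⟨m, hm, hm', rfl⟩
    exact hb ⟨m, hm, by omega, hp⟩)) hc (fun h => hb ⟨8, by decide, by omega, h⟩) hy hz
  by_cases hd : count setI r = 0 ∨ 2 ≤ count setI r + count {xxo} r
  · obtain ⟨h1, h2⟩ := cons_xxo_mem_S2 hI hr hd
    exact .of_S2 hm (asf_cons_alpha hα h1) h2
  -- Here d = 1 and e = 0, so the rest is a single part of 𝓘. Left erases it, or turns `a4` into
  -- `xxo`.
  obtain ⟨p, t, hp, rfl⟩ := exists_of_count_pos (P := setI) (g := r) (by omega)
  rw [count_cons_of_mem hp, count_xxo_cons_of_mem_setI hp] at hd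
  obtain rfl := eq_zero_of_counts (r := t) (fun q hq => hI q (by simp [hq])) (by omega) (by omega)
  obtain ⟨h1, h2⟩ := singleton_altPart_mem_S1 (k := 5) (by decide) (by omega)
  rw [Multiset.cons_swap]
  rcases hp with rfl | rfl | rfl
  · exact .of_S1 (move_a2 _) (asf_x h2.1.2.2 h1) h2
  · obtain ⟨h3, h4⟩ := cons_xxo_mem_S1 h2.1.2.2 h2.1.2.1.noCancel h2.2.1 h2.2.2.1
      (count_singleton_of_notMem (by simp)) (by rw [count_singleton_of_mem h5])
    exact .of_S1 (move_a4 _) h3 h4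
  · exact .of_S1 (move_ooPart_five (n := 1) (by omega) _)
      (asf_cons_alpha (by decide) (asf_cons_alpha hα h1)) h2

/-- For n ≥ 11 the move o(n) → xxo + o(n−4) keeps `a`, and `xxo` excludes `Q`. It fails for n = 13,
as `o9` is not in 𝒪'; there and for n = 7 Left plays o(n) → x + o(n−2). -/
theorem hasGoodMove_of_O' {n : ℕ} (hn : Odd n) (hn' : n = 5 ∨ n = 7 ∨ 11 ≤ n) {r : Game}
    (hK : ∀ p ∈ r, p ∈ setK) (hr : NoCancel r) (hy : count setA' r = 0)
    (hz : count setoA' r = 0) (hc : count setoOo' r = 0) : HasGoodMove (altPart n ::ₘ r) := by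
  rcases hn' with rfl | rfl | hn'
  · exact hasGoodMove_of_O'_five hK hr hy hz hc
  · by_cases hQ : altPart 5 ::ₘ r ∈ setQ
    · rcases cons_altPart_odd_mem_setQ (by decide) hQ with ⟨-, rfl⟩ | h | h
      · obtain ⟨h1, h2⟩ := singleton_altPart_mem_S1 (k := 7) (by decide) (by omega)
        have e : altPart 7 ::ₘ {altPart 2} = altPart 2 ::ₘ {altPart 7} := Multiset.cons_swap _ _ _
        rw [e]
        exact .of_S1 (move_a2 _) (asf_x h2.1.2.2 h1) h2
      · omega
      · omega
    · obtain ⟨h1, h2⟩ := cons_altPart_odd_mem_S1 (by decide) (by omega) hK hr hy hz (by omega) hQ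
      exact .of_S1 (move_altPart_two (n := 5) (by omega) _) (asf_x h2.1.2.2 h1) h2
  rcases eq_or_ne n 13 with rfl | hn13
  · obtain ⟨h1, h2⟩ := cons_altPart_odd_mem_S1 (k := 11) (by decide) (by omega) hK hr hy hz
      (by omega) fun hQ => by
        have := cons_altPart_odd_mem_setQ (by decide) hQ; omega
    exact .of_S1 (move_altPart_two (n := 11) (by omega) _) (asf_x h2.1.2.2 h1) h2
  obtain ⟨k, rfl⟩ := Nat.exists_eq_add_of_le' (show 4 ≤ n by omega)
  have hk : Odd k := by obtain ⟨j, hj⟩ := hn; exact ⟨j - 2, by omega⟩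
  have hk' : k = 5 ∨ k = 7 ∨ 11 ≤ k := by obtain ⟨j, rfl⟩ := hk; omega
  have hke : ¬ Even k := Nat.not_even_iff_odd.2 hk
  obtain ⟨h1, h2⟩ := cons_xxo_mem_S1 (r := altPart k ::ₘ r)
    (by
      rw [Multiset.forall_mem_cons, altPart_mem_setK]
      exact ⟨by obtain ⟨j, rfl⟩ := hk; omega, hK⟩)
    (hr.cons (neg_altPart_odd_notMem hk hK)) (by rwa [count_cons_of_notMem (by simp [hke])])
    (by rwa [count_cons_of_notMem (by simp)]) (by rwa [count_cons_of_notMem (by simp)])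
    (by rw [count_cons_of_mem (by simp [hk, hk'])]; omega)
  exact .of_S1 (move_altPart_four hk.pos _) h1 h2

/-- For general n the move is oo(n) → ox + o(n−3). Where o(n−3) is `o7`, `o9` or `o15`, that is for
n = 10, 12, 18, the move oo(n) → ooxx + o(n−5) is used, unless it would land in `Q`. -/
theorem hasGoodMove_of_oO' {n : ℕ} (hn : Even n) (hn' : 10 ≤ n) {r : Game}
    (hK : ∀ p ∈ r, p ∈ setK) (hr : NoCancel r) (hy : count setA' r = 0)
    (hz : count setoA' r = 0) (hc : count setoOo' r ≤ count setO' r) :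
    HasGoodMove (ooPart n ::ₘ r) := by
  rcases eq_or_ne n 10 with rfl | hn10
  · by_cases hQ : altPart 5 ::ₘ r ∈ setQ
    · rcases cons_altPart_odd_mem_setQ (by decide) hQ with ⟨-, rfl⟩ | h | h
      -- oo10 + a2 → ox + o7 + a2, where the two copies of `ox` cancel.
      · obtain ⟨h1, h2⟩ := singleton_altPart_mem_S1 (k := 7) (by decide) (by omega)
        have hs : Step (altPart 2 ::ₘ -altPart 2 ::ₘ {altPart 7}) {altPart 7} :=
          step_cancel (by simp [neg_altPart_of_even even_two])
        rw [neg_altPart_of_even even_two] at hs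
        refine .of_S1 (move_ooPart_alt (n := 7) (by omega) _) (.of_step ?_ h1) h2
        rwa [show altPart 7 ::ₘ {altPart 2} = altPart 2 ::ₘ {altPart 7} from
          Multiset.cons_swap _ _ _]
      · omega
      · omega
    · obtain ⟨h1, h2⟩ := cons_altPart_odd_mem_S1 (by decide) (by omega) hK hr hy hz hc hQ
      exact .of_S1 (move_ooPart_five (n := 5) (by omega) _) (asf_cons_alpha (by decide) h1) h2
  rcases eq_or_ne n 12 with rfl | hn12
  · by_cases hQ : altPart 7 ::ₘ r ∈ setQ
    · rcases cons_altPart_odd_mem_setQ (by decide) hQ with h | ⟨-, rfl⟩ | h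
      · omega
      -- oo12 + a4 → oo8 + xxo + a4, which is in `LL`.
      · refine .of_LL (move_oo12 _) (h' := ooPart 8 ::ₘ xxo ::ₘ {altPart 4})
          (asf_self (by simp [ooPart_mem_setK]) ?_) (Or.inr (Or.inl rfl))
        exact ((noCancel_zero.cons (p := altPart 4) (by decide)).cons (by decide)).cons (by decide)
      · omega
    · obtain ⟨h1, h2⟩ := cons_altPart_odd_mem_S1 (by decide) (by omega) hK hr hy hz hc hQ
      exact .of_S1 (move_ooPart_five (n := 7) (by omega) _) (asf_cons_alpha (by decide) h1) h2
  rcases eq_or_ne n 18 with rfl | hn18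
  · obtain ⟨h1, h2⟩ := cons_altPart_odd_mem_S1 (k := 13) (by decide) (by omega) hK hr hy hz hc
      fun hQ => by have := cons_altPart_odd_mem_setQ (by decide) hQ; omega
    exact .of_S1 (move_ooPart_five (n := 13) (by omega) _) (asf_cons_alpha (by decide) h1) h2
  obtain ⟨k, rfl⟩ := Nat.exists_eq_add_of_le' (show 3 ≤ n by omega)
  have hk : Odd k := by obtain ⟨j, hj⟩ := hn; exact ⟨j - 2, by omega⟩
  have hk' : k = 11 ∨ k = 13 ∨ 17 ≤ k := by obtain ⟨j, rfl⟩ := hk; omega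
  have hke : ¬ Even k := Nat.not_even_iff_odd.2 hk
  have hK' : ∀ p ∈ altPart 2 ::ₘ altPart k ::ₘ r, p ∈ setK := by
    rw [Multiset.forall_mem_cons, Multiset.forall_mem_cons, altPart_mem_setK, altPart_mem_setK]
    exact ⟨by omega, by omega, hK⟩
  obtain ⟨h, h1, h2⟩ := exists_asf_mem_S1 hK'
    (by rwa [count_cons_of_notMem (by simp), count_cons_of_notMem (by simp [hke])])
    (by rwa [count_cons_of_notMem (by simp), count_cons_of_notMem (by simp)])
    (by
      rw [count_cons_of_notMem (by simp), count_cons_of_notMem (by simp),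
        count_cons_of_notMem (by simp), count_cons_of_mem (altPart_mem_setO'.2 ⟨hk, by omega⟩)]
      omega)
    (Or.inr ⟨altPart k, by simp, neg_altPart_odd_notMem hk hK', by
      simp only [ne_eq, altPart_inj]; omega⟩)
  exact .of_S1 (move_ooPart_alt hk.pos _) h1 h2

/-- The move oo8 → ox + o5 works unless `oo8` is alone, when it gives o5 + a2 in `Q`. In that case
oo8 → ooxo + xxo, with standard form xxo + xxo + a2 in 𝒮₂. -/
theorem hasGoodMove_of_oo8 {r : Game} (hK : ∀ p ∈ r, p ∈ setK) (hr : NoCancel r)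
    (hy : count setA' r = 0) (hz : count setoA' r = 0) (hc : count setoOo' r ≤ count setO' r) :
    HasGoodMove (ooPart 8 ::ₘ r) := by
  have hm := move_ooPart_alt (n := 5) (by omega) r
  by_cases h2 : altPart 2 ∈ r
  · obtain ⟨t, rfl⟩ := Multiset.exists_cons_of_mem h2
    have hKt : ∀ p ∈ t, p ∈ setK := fun p hp => hK p (by simp [hp])
    have h2t : altPart 2 ∉ t := by
      simpa only [neg_altPart_of_even even_two] using hr.neg_notMem
    rw [count_cons_of_notMem (by simp)] at hy hz hc
    rw [count_cons_of_notMem (by simp)] at hc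
    obtain ⟨h1, h2⟩ := cons_altPart_odd_mem_S1 (k := 5) (by decide) (by omega) hKt hr.of_cons
      hy hz hc fun hQ => by
        rcases cons_altPart_odd_mem_setQ (by decide) hQ with ⟨-, rfl⟩ | h | h
        · simp at h2t
        · omega
        · omega
    have hs : Step (altPart 2 ::ₘ -altPart 2 ::ₘ altPart 5 ::ₘ t) (altPart 5 ::ₘ t) :=
      step_cancel (by simpa [neg_altPart_of_even even_two] using hKt)
    rw [neg_altPart_of_even even_two, Multiset.cons_swap (altPart 2) (altPart 5)] at hs
    exact .of_S1 hm (.of_step hs h1) h2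
  by_cases h0 : r = 0
  · subst h0
    have hI : ∀ p ∈ altPart 2 ::ₘ {xxo}, p ∈ setI ∨ p = xxo := by simp
    have hN : NoCancel (altPart 2 ::ₘ {xxo}) :=
      (noCancel_zero.cons (p := xxo) (by decide)).cons (by decide)
    obtain ⟨h1, h2⟩ := cons_xxo_mem_S2 hI hN (Or.inr (by
      rw [count_cons_of_mem (by simp), count_xxo_cons_of_mem_setI (by simp),
        count_singleton_of_notMem (by simp), count_singleton_of_mem (by simp)]))
    refine .of_S2 (move_oo8 _) (.of_step (step_eta (by simp) ?_) h1) h2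
    exact noCancel_zero.cons (p := xxo) (by decide)
  · have hN : NoCancel (altPart 2 ::ₘ r) := hr.cons (by rwa [neg_altPart_of_even even_two])
    have hcons : ∀ P : Set Part, altPart 2 ∉ P → count P (altPart 2 ::ₘ r) = count P r :=
      fun P hP => count_cons_of_notMem hP r
    obtain ⟨h1, h2⟩ := cons_altPart_odd_mem_S1 (k := 5) (by decide) (by omega)
      (r := altPart 2 ::ₘ r) (by simpa using hK) hN (by rwa [hcons _ (by simp)])
      (by rwa [hcons _ (by simp)]) (by rwa [hcons _ (by simp), hcons _ (by simp)]) fun hQ => by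
        rcases cons_altPart_odd_mem_setQ (by decide) hQ with ⟨-, h⟩ | h | h
        · exact h0 ((Multiset.cons_inj_right (altPart 2)).1 h)
        · omega
        · omega
    rw [Multiset.cons_swap] at h1 h2
    exact .of_S1 hm h1 h2

/-- For moves that erase one part: what remains is 0 or consists of copies of `xxo`, which is in 𝒮₂
with d = 0. -/
theorem hasGoodMove_of_asf_I {g h r : Game} (hm : Move x g h)
    (ha : ASF r r → ASF h r) (hr : ∀ p ∈ r, p ∈ setI ∨ p = xxo) (hn : NoCancel r)
    (hd : count setI r = 0) : HasGoodMove g := by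
  have h1 := ha (asf_self (mem_setK_of_I hr) hn)
  by_cases h0 : r = 0
  · subst h0
    exact .of_zero hm h1
  · refine .of_S2 hm h1 (mem_S2 h0 hn hr ?_ (Or.inl hd))
    by_contra he
    exact h0 (eq_zero_of_counts hr hd (by omega))

/-- Even alternating rows are their own negatives, so in the absence of `oo6` all other parts are
`xxo`. If there are none, a4 → x + ox and the two copies of `ox` cancel; otherwise a4 → xxo makes d
+ e ≥ 3. -/
theorem hasGoodMove_of_a4_a2 {t : Game} (ht : ∀ p ∈ t, p ∈ setI ∨ p = xxo) (h6 : ooPart 6 ∉ t)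
    (hn : NoCancel (altPart 4 ::ₘ altPart 2 ::ₘ t)) :
    HasGoodMove (altPart 4 ::ₘ altPart 2 ::ₘ t) := by
  have e2 := neg_altPart_of_even even_two
  have e4 : -altPart 4 = altPart 4 := neg_altPart_of_even (by decide)
  have h2 := hn.of_cons.neg_notMem
  have h4 := hn.neg_notMem
  rw [e2] at h2
  rw [e4] at h4
  have hd : count setI t = 0 := count_eq_zero.2 fun p hp hpI => by
    rcases hpI with rfl | rfl | rfl
    · exact h2 hp
    · exact h4 (by simp [hp])
    · exact h6 hp
  by_cases he : count {xxo} t = 0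
  · obtain rfl := eq_zero_of_counts ht hd he
    have hs : Step (altPart 2 ::ₘ -altPart 2 ::ₘ 0) 0 := step_cancel (by simp [e2])
    rw [e2] at hs
    exact .of_zero (move_altPart_two (n := 2) (by omega) _)
      (asf_x (by simp) (.of_step hs (asf_self (by simp) noCancel_zero)))
  · obtain ⟨h3, h4⟩ := cons_xxo_mem_S2 (r := altPart 2 ::ₘ t) (by simpa using ht) hn.of_cons
      (Or.inr (by
        rw [count_cons_of_mem (by simp), count_xxo_cons_of_mem_setI (by simp)]
        omega))
    exact .of_S2 (move_a4 _) h3 h4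

/-- oo6 → oo + xxo suffices unless the rest is a single part of 𝓘. Then oo6 → ooxo + x gives xxo +
ox beside that part: either `ox` cancels it, so that d = 0, or d + e = 3. -/
theorem hasGoodMove_of_oo6 {r : Game} (hr : ∀ p ∈ r, p ∈ setI ∨ p = xxo) (hn : NoCancel r)
    (hd : 1 ≤ count setI r) : HasGoodMove (ooPart 6 ::ₘ r) := by
  by_cases he : 2 ≤ count setI r + count {xxo} r
  · obtain ⟨h1, h2⟩ := cons_xxo_mem_S2 hr hn (Or.inr he)
    exact .of_S2 (move_oo6_xxo r) (asf_cons_alpha (by decide) h1) h2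
  obtain ⟨p, t, hp, rfl⟩ := exists_of_count_pos (P := setI) (g := r) (by omega)
  rw [count_cons_of_mem hp, count_xxo_cons_of_mem_setI hp] at he
  obtain rfl := eq_zero_of_counts (r := t) (fun q hq => hr q (by simp [hq])) (by omega) (by omega)
  have hK := mem_setK_of_I hr
  have hm := move_oo6_oo4 (p ::ₘ 0)
  rw [Multiset.cons_swap (ooPart 4)] at hm
  have key : ∀ h, ASF (xxo ::ₘ altPart 2 ::ₘ p ::ₘ 0) h →
      ASF (part [x] ::ₘ ooPart 4 ::ₘ p ::ₘ 0) h := fun h h1 =>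
    .of_step (step_neg_alpha (by decide) (by decide) fun q hq => by
      rcases Multiset.mem_cons.1 hq with rfl | hq
      · decide
      · exact (notMem_lhs (hK q hq) lhsα_subset).1) (.of_step (step_eta hK hn) h1)
  by_cases h2 : p = altPart 2
  · subst h2
    have hs : Step (altPart 2 ::ₘ -altPart 2 ::ₘ xxo ::ₘ 0) (xxo ::ₘ 0) :=
      step_cancel (by simp [neg_altPart_of_even even_two])
    rw [neg_altPart_of_even even_two] at hs
    obtain ⟨h3, h4⟩ := cons_xxo_mem_S2 (r := 0) (by simp) noCancel_zero (Or.inl (count_zero _))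
    refine .of_S2 hm (key _ (.of_step ?_ h3)) h4
    rwa [Multiset.cons_swap, Multiset.cons_swap xxo]
  · obtain ⟨h3, h4⟩ := cons_xxo_mem_S2 (r := altPart 2 ::ₘ p ::ₘ 0) (by simp [hp])
      (hn.cons (by rw [neg_altPart_of_even even_two]; simpa using Ne.symm h2)) (Or.inr (by
        rw [count_cons_of_mem (by simp), count_cons_of_mem hp]; omega))
    exact .of_S2 hm (key _ h3) h4

/-- If d ≤ 1, Left erases a part or plays a4 → xxo to reach d = 0. If d ≥ 2, either `oo6` occurs, or
standard form forces exactly one `a2` and one `a4`. -/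
theorem hasGoodMove_of_I {g : Game} (h0 : g ≠ 0) (hg : ∀ p ∈ g, p ∈ setI ∨ p = xxo)
    (hn : NoCancel g) : HasGoodMove g := by
  by_cases hd : count setI g = 0
  · obtain ⟨p, hp⟩ := Multiset.exists_mem_of_ne_zero h0
    obtain rfl : p = xxo := (hg p hp).resolve_left (count_eq_zero.1 hd p hp)
    obtain ⟨r, rfl⟩ := Multiset.exists_cons_of_mem hp
    have hr : ∀ p ∈ r, p ∈ setI ∨ p = xxo := fun q hq => hg q (by simp [hq])
    rw [count_setI_cons_xxo] at hd
    exact hasGoodMove_of_asf_I (move_xxo r) (asf_x_x (mem_setK_of_I hr)) hr hn.of_cons hd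
  by_cases h6 : ooPart 6 ∈ g
  · obtain ⟨r, rfl⟩ := Multiset.exists_cons_of_mem h6
    have hr : ∀ p ∈ r, p ∈ setI ∨ p = xxo := fun q hq => hg q (by simp [hq])
    by_cases hd' : count setI r = 0
    · exact hasGoodMove_of_asf_I (move_ooPart_five (n := 1) (by omega) r)
        (fun h => asf_cons_alpha (by decide) (asf_cons_alpha (by decide) h)) hr hn.of_cons hd'
    · exact hasGoodMove_of_oo6 hr hn.of_cons (by omega)
  obtain ⟨p, r, hp, rfl⟩ := exists_of_count_pos (P := setI) (g := g) (by omega)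
  have hr : ∀ p ∈ r, p ∈ setI ∨ p = xxo := fun q hq => hg q (by simp [hq])
  by_cases hd' : count setI r = 0
  · rcases hp with rfl | rfl | rfl
    · exact hasGoodMove_of_asf_I (move_a2 r) (asf_x (mem_setK_of_I hr)) hr hn.of_cons hd'
    · obtain ⟨h1, h2⟩ := cons_xxo_mem_S2 hr hn.of_cons (Or.inl hd')
      exact .of_S2 (move_a4 r) h1 h2
    · exact absurd (Multiset.mem_cons_self _ _) h6
  obtain ⟨q, t, hq, rfl⟩ := exists_of_count_pos (P := setI) (g := r) (by omega)
  have ht : ∀ p ∈ t, p ∈ setI ∨ p = xxo := fun q hq => hr q (by simp [hq])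
  have h6t : ooPart 6 ∉ t := fun h => h6 (by simp [h])
  rcases hp with rfl | rfl | rfl
  · rcases hq with rfl | rfl | rfl
    · exact absurd (Multiset.mem_cons_self _ _)
        (neg_altPart_of_even even_two ▸ hn.neg_notMem)
    · rw [Multiset.cons_swap] at hn ⊢
      exact hasGoodMove_of_a4_a2 ht h6t hn
    · exact absurd (by simp) h6
  · rcases hq with rfl | rfl | rfl
    · exact hasGoodMove_of_a4_a2 ht h6t hn
    · exact absurd (Multiset.mem_cons_self _ _)
        (neg_altPart_of_even (show Even 4 by decide) ▸ hn.neg_notMem)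
    · exact absurd (by simp) h6
  · exact absurd (by simp) h6

/-- The order of the cases supplies their hypotheses: 𝒜' and o𝒜' come first so that y = z = 0
afterwards, and o𝒪o' precedes 𝒪' because the moves there that create `xxo` need c = 0. -/
theorem hasGoodMove_of_mem_S0 {g : Game} (hg : g ∈ S0) : HasGoodMove g := by
  obtain ⟨⟨h0, hs, hK⟩, hcase⟩ := hg
  have hN := hs.noCancel
  simp only [cntY, cntZ, cntC, cntA] at hcase
  by_cases hy : 0 < count setA' g
  · obtain ⟨p, r, ⟨n, hn, hn', rfl⟩, rfl⟩ := exists_of_count_pos hy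
    have ho : ¬ Odd n := Nat.not_odd_iff_even.2 hn
    rw [count_cons_of_mem (by simp [hn, hn']), count_cons_of_notMem (by simp),
      count_cons_of_notMem (by simp), count_cons_of_notMem (by simp [ho])] at hcase
    exact hasGoodMove_of_A' hn hn' (fun p hp => hK p (by simp [hp])) hN.of_cons (by omega)
      (by omega) (by omega)
  by_cases hz : 0 < count setoA' g
  · obtain ⟨p, r, ⟨n, hn, hn', rfl⟩, rfl⟩ := exists_of_count_pos hz
    have h2 : 2 ≤ n := by omega
    rw [count_cons_of_notMem (ooPart_notMem_setA' h2),
      count_cons_of_mem (by simp [ooPart_mem_setoA' h2, hn, hn']),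
      count_cons_of_notMem (by rw [ooPart_mem_setoOo' h2]; omega),
      count_cons_of_notMem (ooPart_notMem_setO' h2)] at hcase
    exact hasGoodMove_of_oA' hn hn' (fun p hp => hK p (by simp [hp])) hN.of_cons (by omega)
      (by omega) (by omega)
  -- Removing a part never raises a count, so zero counts pass to the rest of the game.
  have hle := fun (P : Set Part) (p : Part) (r : Game) =>
    Multiset.singleton_add p r ▸ add_comm r {p} ▸ count_le_of_add P r {p}
  by_cases hc : 0 < count setoOo' g
  · obtain ⟨p, r, hp, rfl⟩ := exists_of_count_pos hc
    have hKr : ∀ q ∈ r, q ∈ setK := fun q hq => hK q (by simp [hq])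
    have hy' := hle setA' p r
    have hz' := hle setoA' p r
    rw [count_cons_of_mem hp] at hcase
    rcases hp with rfl | ⟨n, hn, hn', rfl⟩
    · rw [count_cons_of_notMem (ooPart_notMem_setO' (by omega))] at hcase
      exact hasGoodMove_of_oox hKr hN (by omega) (by omega) (by omega)
    · have hO : ooPartoo n ∉ setO' := by
        rintro ⟨m, -, -, h⟩
        exact altPart_ne_ooPartoo m (by omega) hn h.symm
      rw [count_cons_of_notMem hO] at hcase
      exact hasGoodMove_of_ooPartoo hn hn' hKr (by omega) (by omega) (by omega)
  by_cases ha : 0 < count setO' g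
  · obtain ⟨p, r, ⟨n, hn, hn', rfl⟩, rfl⟩ := exists_of_count_pos ha
    have hy' := hle setA' (altPart n) r
    have hz' := hle setoA' (altPart n) r
    have hc' := hle setoOo' (altPart n) r
    exact hasGoodMove_of_O' hn hn' (fun p hp => hK p (by simp [hp])) hN.of_cons (by omega)
      (by omega) (by omega)
  by_cases hb : 0 < count setoO' g
  · obtain ⟨p, r, ⟨n, hn, hn', rfl⟩, rfl⟩ := exists_of_count_pos hb
    have hy' := hle setA' (ooPart n) r
    have hz' := hle setoA' (ooPart n) r
    have hc' := hle setoOo' (ooPart n) r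
    exact hasGoodMove_of_oO' hn hn' (fun p hp => hK p (by simp [hp])) hN.of_cons (by omega)
      (by omega) (by omega)
  by_cases hf : ooPart 8 ∈ g
  · obtain ⟨r, rfl⟩ := Multiset.exists_cons_of_mem hf
    have hy' := hle setA' (ooPart 8) r
    have hz' := hle setoA' (ooPart 8) r
    have hc' := hle setoOo' (ooPart 8) r
    exact hasGoodMove_of_oo8 (fun p hp => hK p (by simp [hp])) hN.of_cons (by omega)
      (by omega) (by omega)
  exact hasGoodMove_of_I h0 (mem_I_or_xxo hK (by omega) (by omega) (by omega) hf (by omega)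
    (by omega)) hN

/-! ### Moves on lists of rows -/

/-- The game formed by a list of rows. -/
def toGame (ls : List (List Stone)) : Game := (ls.map row).sum

theorem toGame_cons (l : List Stone) (ls : List (List Stone)) :
    toGame (l :: ls) = row l + toGame ls := by simp [toGame]

/-- The pairs of rows to which the player `s` can move from the row `u ++ l` by a move
within `l`. -/
def rowMoves (s : Stone) : List Stone → List Stone → List (List Stone × List Stone)
  | u, a :: b :: v =>
    match s, a, b with
    | x, x, o => (u, x :: v) :: rowMoves s (u ++ [a]) (b :: v)
    | o, o, x => (u, o :: v) :: rowMoves s (u ++ [a]) (b :: v)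
    | x, o, x => (u ++ [x], v) :: rowMoves s (u ++ [a]) (b :: v)
    | o, x, o => (u ++ [o], v) :: rowMoves s (u ++ [a]) (b :: v)
    | _, _, _ => rowMoves s (u ++ [a]) (b :: v)
  | _, _ => []

theorem rowMoves_cons_cons (s : Stone) (u : List Stone) (a b : Stone) (v : List Stone) :
    rowMoves s u (a :: b :: v) =
      (if a = s ∧ b = s.other then [(u, s :: v)]
        else if a = s.other ∧ b = s then [(u ++ [s], v)] else []) ++
      rowMoves s (u ++ [a]) (b :: v) := by
  cases s <;> cases a <;> cases b <;> rfl

theorem rowMove_of_mem_rowMoves {s : Stone} {q : List Stone × List Stone} :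
    ∀ {l u : List Stone}, q ∈ rowMoves s u l → RowMove s (u ++ l) (row q.1 + row q.2)
  | [], u, h => by simp [rowMoves] at h
  | [a], u, h => by simp [rowMoves] at h
  | a :: b :: v, u, h => by
    rw [rowMoves_cons_cons, List.mem_append] at h
    rcases h with h | h
    · split_ifs at h with h1 h2
      · obtain ⟨rfl, rfl⟩ := h1
        obtain rfl := List.mem_singleton.1 h
        exact .clobberRight u v
      · obtain ⟨rfl, rfl⟩ := h2
        obtain rfl := List.mem_singleton.1 h
        exact .clobberLeft u v
      · simp at h
    · simpa using rowMove_of_mem_rowMoves (l := b :: v) (u := u ++ [a]) h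

/-- The prefix is an accumulator: a scan of the whole row passes through every split, so it finds
each move found from an intermediate position. -/
theorem rowMoves_subset (s : Stone) (w : List Stone) {q : List Stone × List Stone} :
    ∀ (l u : List Stone), q ∈ rowMoves s (u ++ l) w → q ∈ rowMoves s u (l ++ w)
  | [], u, h => by simpa using h
  | a :: l, u, h => by
    have := rowMoves_subset s w l (u ++ [a]) (by simpa using h)
    cases hl : l ++ w with
    | nil => rw [hl] at this; simp [rowMoves] at this
    | cons b v =>
      rw [List.cons_append, hl, rowMoves_cons_cons]
      exact List.mem_append_right _ (hl ▸ this)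

theorem exists_mem_rowMoves {s : Stone} {l : List Stone} {j : Game} (h : RowMove s l j) :
    ∃ q ∈ rowMoves s [] l, j = row q.1 + row q.2 := by
  cases h with
  | clobberRight u v =>
    refine ⟨(u, s :: v), rowMoves_subset s _ u [] ?_, rfl⟩
    rw [rowMoves_cons_cons]
    simp
  | clobberLeft u v =>
    refine ⟨(u ++ [s], v), rowMoves_subset s _ u [] ?_, rfl⟩
    rw [rowMoves_cons_cons]
    cases s <;> simp

theorem row_reverse (l : List Stone) : row l.reverse = row l := by
  cases h : l with
  | nil => rfl
  | cons s t => rw [← h, row_eq (by simp [h]), row_eq (by simp [h]), part_reverse]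

theorem RowMove.reverse {s : Stone} {l : List Stone} {j : Game} (h : RowMove s l j) :
    RowMove s l.reverse j := by
  cases h with
  | clobberRight u v =>
    have := RowMove.clobberLeft (s := s) v.reverse u.reverse
    rw [row_reverse, ← List.reverse_cons, row_reverse, add_comm] at this
    simpa using this
  | clobberLeft u v =>
    have := RowMove.clobberRight (s := s) v.reverse u.reverse
    have e : s :: u.reverse = (u ++ [s]).reverse := by simp
    rw [row_reverse, e, row_reverse, add_comm] at this
    simpa using this

/-- The lists of rows to which the player `s` can move. -/
def listMoves (s : Stone) : List (List Stone) → List (List (List Stone))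
  | [] => []
  | l :: ls => (rowMoves s [] l).map (fun q => q.1 :: q.2 :: ls) ++
      (listMoves s ls).map (fun m => l :: m)

theorem Move.add_left {s : Stone} {g h : Game} (hm : Move s g h) (k : Game) :
    Move s (k + g) (k + h) := by
  obtain ⟨l, j, r, h1, rfl, rfl⟩ := hm
  exact ⟨l, j, k + r, h1, by simp, by rw [add_left_comm]⟩

theorem Move.add_right {s : Stone} {g h : Game} (hm : Move s g h) (k : Game) :
    Move s (g + k) (h + k) := by
  rw [add_comm g, add_comm h]; exact hm.add_left k

theorem not_move_zero {s : Stone} {h : Game} : ¬ Move s 0 h := by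
  rintro ⟨l, j, r, -, h1, -⟩
  exact Multiset.zero_ne_cons h1

theorem move_of_mem_listMoves {s : Stone} {m : List (List Stone)} :
    ∀ {ls : List (List Stone)}, m ∈ listMoves s ls → Move s (toGame ls) (toGame m)
  | [], h => by simp [listMoves] at h
  | l :: ls, h => by
    rcases List.mem_append.1 h with h | h
    · obtain ⟨q, hq, rfl⟩ := List.mem_map.1 h
      have h1 := rowMove_of_mem_rowMoves hq
      rw [List.nil_append] at h1
      have hl : l ≠ [] := by
        rintro rfl
        simp [rowMoves] at hq
      refine ⟨l, _, toGame ls, h1, ?_, ?_⟩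
      · rw [toGame_cons, row_eq hl, Multiset.singleton_add]
      · rw [toGame_cons, toGame_cons, add_assoc]
    · obtain ⟨k, hk, rfl⟩ := List.mem_map.1 h
      rw [toGame_cons, toGame_cons]
      exact (move_of_mem_listMoves hk).add_left _

/-- A move in a sum is a move in one of the summands. -/
theorem Move.of_add {s : Stone} {g k h : Game} (hm : Move s (g + k) h) :
    (∃ g', Move s g g' ∧ h = g' + k) ∨ ∃ k', Move s k k' ∧ h = g + k' := by
  obtain ⟨l, j, r, h1, h2, rfl⟩ := hm
  have hp : part l ∈ g + k := h2 ▸ Multiset.mem_cons_self _ _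
  rcases Multiset.mem_add.1 hp with hp | hp
  · obtain ⟨t, rfl⟩ := Multiset.exists_cons_of_mem hp
    rw [Multiset.cons_add, Multiset.cons_inj_right] at h2
    exact Or.inl ⟨j + t, ⟨l, j, t, h1, rfl, rfl⟩, by rw [← h2, add_assoc]⟩
  · obtain ⟨t, rfl⟩ := Multiset.exists_cons_of_mem hp
    rw [Multiset.add_cons, Multiset.cons_inj_right] at h2
    exact Or.inr ⟨j + t, ⟨l, j, t, h1, rfl, rfl⟩, by rw [← h2, add_left_comm]⟩

/-- A part may be presented by either of its two readings, so the move may have to be reversed. -/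
theorem move_row {s : Stone} {l : List Stone} {h : Game} (hm : Move s (row l) h) :
    RowMove s l h := by
  obtain ⟨l', j, r, h1, h2, rfl⟩ := hm
  cases l with
  | nil => exact absurd h2 Multiset.zero_ne_cons
  | cons a l =>
    have h3 : part (a :: l) ::ₘ 0 = part l' ::ₘ r := h2
    rcases Multiset.cons_eq_cons.1 h3 with ⟨h4, rfl⟩ | ⟨-, c, h4, -⟩
    · rw [add_zero]
      rcases Quotient.exact h4 with h5 | h5
      · rwa [h5]
      · rw [h5]; exact h1.reverse
    · exact absurd h4 Multiset.zero_ne_cons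

theorem exists_mem_listMoves {s : Stone} {h : Game} :
    ∀ {ls : List (List Stone)}, Move s (toGame ls) h → ∃ m ∈ listMoves s ls, h = toGame m
  | [], hm => absurd hm not_move_zero
  | l :: ls, hm => by
    rw [toGame_cons] at hm
    rcases hm.of_add with ⟨j, hj, rfl⟩ | ⟨k, hk, rfl⟩
    · obtain ⟨q, hq, rfl⟩ := exists_mem_rowMoves (move_row hj)
      refine ⟨q.1 :: q.2 :: ls, List.mem_append_left _ (List.mem_map.2 ⟨q, hq, rfl⟩), ?_⟩
      rw [toGame_cons, toGame_cons, add_assoc]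
    · obtain ⟨m, hm', rfl⟩ := exists_mem_listMoves hk
      exact ⟨l :: m, List.mem_append_right _ (List.mem_map.2 ⟨m, hm', rfl⟩),
        (toGame_cons l m).symm⟩

/-! ### Positions up to dead rows, reversal and order -/

/-- A row coded as a number whose binary digits, lowest first, are the stones, with a
leading `1`. -/
def encode : List Stone → ℕ
  | [] => 1
  | x :: l => 2 * encode l + 1
  | o :: l => 2 * encode l

/-- The row with a given code; the first argument bounds the length. -/
def decodeAux : ℕ → ℕ → List Stone
  | 0, _ => []
  | k + 1, n =>
    match n with
    | 0 => []
    | 1 => []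
    | n + 2 => (match n % 2 with | 0 => o | _ => x) :: decodeAux k ((n + 2) / 2)

theorem encode_pos (l : List Stone) : 0 < encode l := by
  induction l with
  | nil => exact one_pos
  | cons s l ih => cases s <;> simp only [encode] <;> omega

theorem decodeAux_encode (l : List Stone) :
    ∀ {k : ℕ}, encode l ≤ k → decodeAux k (encode l) = l := by
  induction l with
  | nil => intro k _; cases k <;> rfl
  | cons s l ih =>
    intro k hk
    have hpos := encode_pos l
    -- The leading digit 1 makes the code of a non-empty row at least 2, which selects the recursive
    -- branch of `decodeAux`.
    obtain ⟨n, hn⟩ : ∃ n, encode (s :: l) = n + 2 :=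
      ⟨encode (s :: l) - 2, by cases s <;> simp only [encode] <;> omega⟩
    obtain ⟨j, rfl⟩ : ∃ j, k = j + 1 := ⟨k - 1, by omega⟩
    have hdiv : (n + 2) / 2 = encode l := by
      rw [← hn]; cases s <;> simp only [encode] <;> omega
    rw [hn, decodeAux, hdiv, ih (by omega)]
    cases s with
    | x =>
      rw [show n % 2 = 1 by simp only [encode] at hn; omega]
      rfl
    | o =>
      rw [show n % 2 = 0 by simp only [encode] at hn; omega]
      rfl

/-- The row with a given code. -/
def decode (n : ℕ) : List Stone := decodeAux n n

theorem decode_encode (l : List Stone) : decode (encode l) = l := decodeAux_encode l le_rfl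

/-- Whether a row contains only stones of one colour, so that nobody can move in it. -/
def isDead : List Stone → Bool
  | x :: o :: _ => false
  | o :: x :: _ => false
  | _ :: s :: l => isDead (s :: l)
  | _ => true

theorem not_rowMove_of_isDead {s : Stone} {j : Game} :
    ∀ {l : List Stone}, isDead l = true → ¬ RowMove s l j := by
  have aux : ∀ (l u : List Stone), isDead l = true → rowMoves s u l = [] := by
    intro l
    induction l with
    | nil => intros; rfl
    | cons a l ih =>
      intro u h
      cases l with
      | nil => rfl
      | cons b v =>
        cases a <;> cases b <;> simp only [isDead, Bool.false_eq_true] at h <;>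
          cases s <;> exact ih _ h
  intro l h hm
  obtain ⟨q, hq, -⟩ := exists_mem_rowMoves hm
  rw [aux l [] h] at hq
  simp at hq

/-- The smaller of the codes of a row and of its reverse. -/
def partCode (l : List Stone) : ℕ :=
  bif (encode l).ble (encode l.reverse) then encode l else encode l.reverse

theorem row_decode_partCode (l : List Stone) : row (decode (partCode l)) = row l := by
  cases h : (encode l).ble (encode l.reverse) with
  | true => rw [partCode, h, cond_true, decode_encode]
  | false => rw [partCode, h, cond_false, decode_encode, row_reverse]

/-- Insertion into a sorted list. -/
def insertSorted (n : ℕ) : List ℕ → List ℕ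
  | [] => [n]
  | m :: l => bif n.ble m then n :: m :: l else m :: insertSorted n l

/-- The game formed by the rows with given codes. -/
def ofCodes (w : List ℕ) : Game := toGame (w.map decode)

theorem ofCodes_cons (n : ℕ) (w : List ℕ) : ofCodes (n :: w) = row (decode n) + ofCodes w :=
  toGame_cons _ _

theorem ofCodes_insertSorted (n : ℕ) (w : List ℕ) :
    ofCodes (insertSorted n w) = row (decode n) + ofCodes w := by
  induction w with
  | nil => exact ofCodes_cons n []
  | cons m w ih =>
    cases h : n.ble m with
    | true => simp only [insertSorted, h, cond_true, ofCodes_cons]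
    | false => simp only [insertSorted, h, cond_false, ofCodes_cons, ih, add_left_comm]

/-- The sorted list of the codes of the rows that are not dead. -/
def normalize : List (List Stone) → List ℕ
  | [] => []
  | l :: ls => bif isDead l then normalize ls else insertSorted (partCode l) (normalize ls)

/-- No player can move in the game. -/
def IsDead (d : Game) : Prop := ∀ s h, ¬ Move s d h

theorem IsDead.add {d e : Game} (hd : IsDead d) (he : IsDead e) : IsDead (d + e) :=
  fun s h hm => by
    rcases hm.of_add with ⟨j, hj, -⟩ | ⟨j, hj, -⟩
    exacts [hd s j hj, he s j hj]

/-- Only rows without moves are dropped; reversing and sorting rows do not change the game. Thus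
`normalize` loses nothing but a dead summand. -/
theorem exists_dead (ls : List (List Stone)) :
    ∃ d, IsDead d ∧ toGame ls = ofCodes (normalize ls) + d := by
  induction ls with
  | nil => exact ⟨0, fun s h => not_move_zero, rfl⟩
  | cons l ls ih =>
    obtain ⟨d, hd, e⟩ := ih
    cases h : isDead l with
    | true =>
      refine ⟨row l + d, IsDead.add (fun s k hk => not_rowMove_of_isDead h (move_row hk)) hd, ?_⟩
      simp only [normalize, h, cond_true, toGame_cons, e, add_left_comm]
    | false =>
      refine ⟨d, hd, ?_⟩
      simp only [normalize, h, cond_false, toGame_cons, e, ofCodes_insertSorted,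
        row_decode_partCode, add_assoc]

/-! ### Sets of games in which Left has an answer to every move of Right -/

/-- The number of stones of a game. -/
def stones (g : Game) : ℕ := (g.map (fun p => (inv p).1)).sum

theorem stones_add (g h : Game) : stones (g + h) = stones g + stones h := by simp [stones]

theorem stones_row (l : List Stone) : stones (row l) = l.length := by
  cases l <;> simp [stones, row, inv_part, rowInv]

theorem Move.stones_lt {s : Stone} {g h : Game} (hm : Move s g h) : stones h < stones g := by
  obtain ⟨l, j, r, h1, rfl, rfl⟩ := hm
  rw [← Multiset.singleton_add, stones_add, stones_add]
  have : stones {part l} = l.length := by simp [stones, inv_part, rowInv]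
  rw [this]
  cases h1 with
  | clobberRight u v => simp [stones_add, stones_row]
  | clobberLeft u v =>
    simp [stones_add, stones_row]
    omega

/-- Left has an answer within `S` to every move of Right from a game in `S`. -/
def Answers (S : Set Game) : Prop :=
  ∀ g ∈ S, ∀ h, Move o g h → ∃ k ∈ S, Move x h k

/-- Induction on Right's alleged strategy: Left's answer leads back into `S`, where the induction
hypothesis applies. -/
theorem Answers.not_winsFirst {S : Set Game} (hS : Answers S) {g : Game} (hg : g ∈ S) :
    ¬ WinsFirst o g := by
  intro hw
  induction hw with
  | intro g h hgh _ ih =>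
    obtain ⟨k, hk, hm⟩ := hS g hg h hgh
    exact ih k hm hk

/-- Left keeps answering into `S`; play ends because every move lowers the number of stones. -/
theorem Answers.winsFirst {S : Set Game} (hS : Answers S) (g : Game) {h : Game}
    (hm : Move x g h) (hh : h ∈ S) : WinsFirst x g := by
  refine .intro g h hm fun k hk => ?_
  obtain ⟨q, hq, hm'⟩ := hS h hh k hk
  exact hS.winsFirst k hm' hq
termination_by stones g
decreasing_by exact lt_trans (Move.stones_lt hk) (Move.stones_lt hm)

/-! ### A certificate for `LL ⊆ 𝓛`, checked by evaluation -/

/-- A number that depends on a list of numbers, to compare such lists quickly. -/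
def listCode : List ℕ → ℕ
  | [] => 0
  | n :: l => listCode l * 65536 + n

/-- Whether a list of numbers occurs in a list of such lists. -/
def occurs (w : List ℕ) : List (List ℕ) → Bool
  | [] => false
  | v :: W => bif (listCode w).beq (listCode v) then listBeq w v else occurs w W
where
  /-- Equality of lists of numbers. -/
  listBeq : List ℕ → List ℕ → Bool
    | [], [] => true
    | m :: l, n :: k => (m.beq n) && listBeq l k
    | _, _ => false

theorem eq_of_listBeq : ∀ {w v : List ℕ}, occurs.listBeq w v = true → w = v
  | [], [], _ => rfl
  | m :: l, n :: k, h => by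
    simp only [occurs.listBeq, Bool.and_eq_true] at h
    rw [Nat.eq_of_beq_eq_true h.1, eq_of_listBeq h.2]
  | [], _ :: _, h => by simp [occurs.listBeq] at h
  | _ :: _, [], h => by simp [occurs.listBeq] at h

/-- `listCode` need not be injective: it only filters candidates, and the lists themselves are
compared afterwards. -/
theorem mem_of_occurs {w : List ℕ} {W : List (List ℕ)} (h : occurs w W = true) : w ∈ W := by
  induction W with
  | nil => simp [occurs] at h
  | cons v W ih =>
    cases hv : (listCode w).beq (listCode v) with
    | true =>
      rw [occurs, hv, cond_true] at h
      exact eq_of_listBeq h ▸ List.mem_cons_self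
    | false =>
      rw [occurs, hv, cond_false] at h
      exact List.mem_cons_of_mem _ (ih h)

/-- Whether Left can move to one of the games coded in `W`, up to dead rows. -/
def canReach (W : List (List ℕ)) (ls : List (List Stone)) : Bool :=
  (listMoves x ls).any fun m => occurs (normalize m) W

/-- Whether Left can answer every move of Right from the games coded in `W` by a move to
one of them, up to dead rows. -/
def answersAll (W : List (List ℕ)) : Bool :=
  W.all fun w => (listMoves o (w.map decode)).all fun m => canReach W m

/-- The games coded in `W`, up to dead parts. -/
def gamesOf (W : List (List ℕ)) : Set Game :=
  {g | ∃ w ∈ W, ∃ d, IsDead d ∧ g = ofCodes w + d}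

theorem toGame_mem_gamesOf {W : List (List ℕ)} {ls : List (List Stone)}
    (h : occurs (normalize ls) W = true) : toGame ls ∈ gamesOf W := by
  obtain ⟨d, hd, e⟩ := exists_dead ls
  exact ⟨_, mem_of_occurs h, d, hd, e⟩

theorem exists_move_of_canReach {W : List (List ℕ)} {ls : List (List Stone)}
    (h : canReach W ls = true) : ∃ k ∈ gamesOf W, Move x (toGame ls) k := by
  obtain ⟨m, hm, h⟩ := List.any_eq_true.1 h
  exact ⟨toGame m, toGame_mem_gamesOf h, move_of_mem_listMoves hm⟩

/-- The dead summand offers Right no move, so he moves in the coded part; the dead rows arising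
there and from Left's answer join that summand. -/
theorem answers_gamesOf {W : List (List ℕ)} (hW : answersAll W = true) :
    Answers (gamesOf W) := by
  rintro g ⟨w, hw, d, hd, rfl⟩ h hm
  rcases hm.of_add with ⟨g', hg', rfl⟩ | ⟨d', hd', -⟩
  · obtain ⟨m, hm', rfl⟩ := exists_mem_listMoves hg'
    obtain ⟨k, ⟨v, hv, e, he, rfl⟩, hk⟩ :=
      exists_move_of_canReach (List.all_eq_true.1 (List.all_eq_true.1 hW w hw) m hm')
    exact ⟨ofCodes v + e + d, ⟨v, hv, e + d, he.add hd, add_assoc _ _ _⟩, hk.add_right d⟩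
  · exact absurd hd' (hd o d')

/-- `h1` makes Right lose when he starts, and `h2` gives Left his winning first move. -/
theorem toGame_mem_classL {W : List (List ℕ)} (hW : answersAll W = true)
    {ls : List (List Stone)} (h1 : occurs (normalize ls) W = true) (h2 : canReach W ls = true) :
    toGame ls ∈ classL := by
  obtain ⟨k, hk, hm⟩ := exists_move_of_canReach h2
  exact ⟨(answers_gamesOf hW).winsFirst _ hm hk,
    (answers_gamesOf hW).not_winsFirst (toGame_mem_gamesOf h1)⟩

/-- Codes of games that Left wins when Right moves first; Left can always answer within
the list. -/
def answerCodes : List (List ℕ) :=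
  [[], [11], [298], [5, 5], [5, 10], [5, 18], [5, 43], [5, 2730], [11, 11], [11, 18], [11, 170],
    [11, 682], [5, 5, 11], [5, 5, 42], [5, 5, 170], [5, 5, 298], [5, 9, 682], [5, 11, 11],
    [5, 11, 18], [5, 11, 21], [5, 11, 37], [5, 11, 42], [5, 11, 43], [5, 11, 2730], [9, 11, 11],
    [9, 11, 42], [11, 11, 74], [11, 21, 43], [11, 21, 298], [11, 21, 2730], [5, 5, 5, 5],
    [5, 5, 5, 10], [5, 5, 5, 18], [5, 5, 5, 37], [5, 5, 5, 682], [5, 5, 9, 11], [5, 5, 9, 42],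
    [5, 5, 11, 11], [5, 5, 11, 18], [5, 5, 11, 36], [5, 5, 11, 85], [5, 5, 11, 170],
    [5, 5, 11, 2730], [5, 5, 21, 2730], [5, 9, 11, 18], [5, 9, 11, 43], [5, 9, 11, 2730],
    [5, 9, 21, 42], [5, 11, 11, 21], [5, 11, 11, 27], [5, 11, 11, 107], [5, 11, 11, 3413],
    [5, 11, 18, 21], [5, 11, 21, 170], [5, 11, 21, 682], [5, 11, 21, 1194], [5, 11, 21, 21845],
    [9, 11, 11, 11], [9, 11, 11, 18], [11, 11, 21, 21], [11, 11, 21, 107], [5, 5, 5, 5, 42],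
    [5, 5, 5, 11, 11], [5, 5, 5, 11, 18], [5, 5, 5, 11, 21], [5, 5, 5, 11, 27],
    [5, 5, 5, 11, 170], [5, 5, 9, 11, 11], [5, 5, 9, 11, 85], [5, 5, 9, 11, 170],
    [5, 5, 11, 11, 37], [5, 5, 11, 11, 53], [5, 5, 11, 11, 107], [5, 5, 11, 18, 21],
    [5, 5, 11, 21, 21], [5, 5, 11, 21, 74], [5, 5, 11, 21, 107], [5, 5, 11, 21, 170],
    [5, 9, 11, 11, 21], [5, 9, 11, 11, 74], [5, 11, 11, 18, 21], [5, 11, 11, 21, 213],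
    [5, 11, 11, 21, 597], [5, 11, 18, 21, 85], [5, 11, 21, 107, 170], [9, 9, 11, 11, 11],
    [5, 5, 5, 5, 5, 5], [5, 5, 5, 5, 5, 10], [5, 5, 5, 5, 5, 18], [5, 5, 5, 5, 9, 11],
    [5, 5, 5, 9, 10, 11], [5, 5, 5, 11, 11, 18], [5, 5, 5, 11, 18, 21], [5, 5, 9, 9, 11, 11],
    [5, 5, 9, 11, 11, 18], [5, 5, 11, 11, 11, 21], [5, 5, 11, 11, 13, 21],
    [5, 5, 11, 11, 18, 21], [5, 5, 11, 18, 21, 107], [5, 9, 9, 11, 11, 43],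
    [5, 9, 11, 11, 11, 21], [5, 9, 11, 11, 21, 85], [5, 11, 11, 18, 21, 53],
    [5, 11, 11, 21, 21, 37]]

theorem answersAll_answerCodes : answersAll answerCodes = true := by decide +kernel

theorem setLL_subset_classL : setLL ⊆ classL := by
  rintro g (rfl | rfl | rfl | rfl)
  · exact toGame_mem_classL (ls := [o :: alt o 7]) answersAll_answerCodes
      (by decide +kernel) (by decide +kernel)
  · exact toGame_mem_classL (ls := [o :: alt o 7, [x, x, o], alt o 4]) answersAll_answerCodes
      (by decide +kernel) (by decide +kernel)
  · exact toGame_mem_classL (ls := [alt o 5, o :: alt o 2, alt o 4, alt o 2])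
      answersAll_answerCodes (by decide +kernel) (by decide +kernel)
  · exact toGame_mem_classL (ls := [alt o 14, [x, x, o], alt o 4, alt o 2])
      answersAll_answerCodes (by decide +kernel) (by decide +kernel)

end Clobber

theorem mainTheorem2 :
    (∀ g ∈ Clobber.S0, ∃ h h' : Clobber.Game,
      Clobber.Move Clobber.Stone.x g h ∧ Clobber.ASF h h' ∧
        h' ∈ Clobber.S1 ∪ Clobber.S2 ∪ Clobber.setLL ∪ {0}) ∧
    Clobber.setLL ⊆ Clobber.classL :=
  ⟨fun _ hg => Clobber.hasGoodMove_of_mem_S0 hg, Clobber.setLL_subset_classL⟩
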